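/- **Setting.** Fix $d\in\mathbb N$. Let $\mathbf X_1,\mathbf X_2,\dots$ be i.i.d. random vectors in $\mathbb R^d$, let $\mathcal T$ be a set of maps $\mathbb R^d\to\mathbb R^d$ equipped with a $\sigma$-algebra for which $(\phi,x)\mapsto\phi x$ is measurable, and let $(\phi_{ij})_{i,j\ge1}$ be i.i.d. random elements of $\mathcal T$, independent of $(\mathbf X_i)_i$, with $\mathbb E\|\phi_{11}\mathbf X_1\|^6<\infty$. Write $\Phi_i\mathbf X_i:=(\phi_{i1}\mathbf X_i,\dots,\phi_{ik}\mathbf X_i)\in\mathbb R^{kd}$ and $\Phi\mathcal X:=(\Phi_1\mathbf X_1,\dots,\Phi_n\mathbf X_n)\in\mathbb R^{nkd}$. For each $k$ let $\mathbf Z_1,\mathbf Z_2,\dots$ be i.i.d. (possibly degenerate) Gaussian vectors in $\mathbb R^{kd}$, independent of all $\mathbf X_i$ and $\phi_{ij}$, with $$\mathbb E\mathbf Z_i=\mathbf 1_{k\times1}\otimes\mathbb E[\phi_{11}\mathbf X_1],\qquad \mathrm{Var}[\mathbf Z_i]=\mathbf 1_{k\times k}\otimes\Sigma_{12},\qquad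 \Sigma_{12}:=\mathrm{Cov}[\phi_{11}\mathbf X_1,\phi_{12}\mathbf X_1].$$ For each $n,k$ let $f=f_{n,k}:\mathbb R^{nkd}\to\mathbb R^q$ be three times differentiable ($q$ may depend on $n,k$). **Noise stability.** $\|\cdot\|$ is the flattened Euclidean norm (root of the sum of squared entries) of vectors and tensors, and $\|S\|_{L_m}=\mathbb E[|S|^m]^{1/m}$. Let $D_i^rf$ be the $r$-th derivative of $f(\mathbf v_1,\dots,\mathbf v_n)$ in its $i$-th argument $\mathbf v_i\in\mathbb R^{kd}$, let $\mathbf W_i(\mathbf w):=(\Phi_1\mathbf X_1,\dots,\Phi_{i-1}\mathbf X_{i-1},\mathbf w,\mathbf Z_{i+1},\dots,\mathbf Z_n)$, and $$\alpha^r_m:=\max_{i\le n}\max\Bigl\{\bigl\|\sup_{\mathbf w\in[\mathbf 0,\Phi_i\mathbf X_i]}\|D_i^rf(\mathbf W_i(\mathbf w))\|\bigr\|_{L_m},\ \bigl\|\sup_{\mathbf w\in[\mathbf 0,\mathbf Z_i]}\|D_i^rf(\mathbf W_i(\mathbf w))\|\bigr\|_{L_m}\Bigr\}\in[0,\infty],$$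 which depends on $(n,k)$. **Distance.** Let $\mathcal H$ be the set of three times differentiable $h:\mathbb R^q\to\mathbb R$ with $\|\partial h(\mathbf 0)\|\le1$, $\|\partial^2h(\mathbf 0)\|\le1$ and $\sup_{\mathbf v}\|\partial^3h(\mathbf v)\|\le1$, and let $d_{\mathcal H}(U,V):=\sup_{h\in\mathcal H}|\mathbb Eh(U)-\mathbb Eh(V)|$. **Claim.** Suppose that, as $n,k\to\infty$ (jointly, or along any given regime in which both tend to infinity), the $\alpha^r_6$, $r\le3$, are eventually finite, and $$(\alpha^1_6)^3,\ \alpha^0_6\alpha^1_6\alpha^2_6,\ (\alpha^0_6)^2\alpha^3_6,\ \alpha^1_4\alpha^2_4,\ \alpha^0_4\alpha^3_4,\ \alpha^3_2\;=\;o\Bigl(\frac1{nk^{3/2}}\Bigr),$$ $$\alpha^0_3(\alpha^1_3)^2,\ (\alpha^0_3)^2\alpha^2_3,\ (\alpha^1_2)^2,\ \alpha^0_2\alpha^2_2,\ \alpha^2_1\;=\;o\Bigl(\frac1{nk^{1/2}}\Bigr).$$ Then, along the same regime, eventually $\mathbb Eh(f(\Phi\mathcal X))$ and $\mathbb Eh(f(\mathbf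 Z_1,\dots,\mathbf Z_n))$ exist (the integrands are integrable) for all $h\in\mathcal H$, and $$d_{\mathcal H}\bigl(f(\Phi\mathcal X),f(\mathbf Z_1,\dots,\mathbf Z_n)\bigr)=o(1).$$ -/

import Mathlib

open MeasureTheory ProbabilityTheory Filter Topology Asymptotics
open scoped ENNReal Kronecker

noncomputable section

/-- The space `ℝ^{kd}` of blocks `(x_{jl})_{j ≤ k, l ≤ d}`, with the Euclidean norm. -/
abbrev Block (k d : ℕ) : Type := EuclideanSpace ℝ (Fin k × Fin d)

/-- The class `𝓕_r` of `r` times differentiable functions (the `r`-th derivative exists everywhere;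
it need not be continuous). -/
def TimesDifferentiable {E F : Type*} [NormedAddCommGroup E] [NormedSpace ℝ E]
    [NormedAddCommGroup F] [NormedSpace ℝ F] (r : ℕ) (f : E → F) : Prop :=
  ∀ m < r, Differentiable ℝ (iteratedFDeriv ℝ m f)

/-- The flattened Euclidean (Frobenius) norm of an `r`-tensor `T` on `ℝ^ι` with values in a
Euclidean space: the square root of the sum of all squared entries. -/
def flatNorm {ι F : Type*} [Fintype ι] [DecidableEq ι] [NormedAddCommGroup F] [NormedSpace ℝ F]
    {r : ℕ} (T : ContinuousMultilinearMap ℝ (fun _ : Fin r => EuclideanSpace ℝ ι) F) : ℝ :=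
  √(∑ s : Fin r → ι, ‖T fun a => EuclideanSpace.single (s a) (1 : ℝ)‖ ^ 2)

/-- `D_i^r f (v_1, …, v_n)`: the `r`-th derivative of `f` in its `i`-th block argument. -/
def blockDeriv {n k d q : ℕ} (r : ℕ) (f : (Fin n → Block k d) → EuclideanSpace ℝ (Fin q))
    (i : Fin n) (v : Fin n → Block k d) :
    ContinuousMultilinearMap ℝ (fun _ : Fin r => Block k d) (EuclideanSpace ℝ (Fin q)) :=
  iteratedFDeriv ℝ r (fun w => f (Function.update v i w)) (v i)

/-- `W_i(w) = (y_1, …, y_{i-1}, w, z_{i+1}, …, z_n)`. -/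
def interpolate {n : ℕ} {B : Type*} (y z : Fin n → B) (i : Fin n) (w : B) : Fin n → B :=
  fun j => if j < i then y j else if j = i then w else z j

/-- `‖S‖_{L_m} = 𝔼[S^m]^{1/m}` for a `[0,∞]`-valued random variable `S`. -/
def momentNorm {Ω : Type*} [MeasurableSpace Ω] (P : Measure Ω) (m : ℕ) (S : Ω → ℝ≥0∞) : ℝ≥0∞ :=
  (∫⁻ ω, S ω ^ m ∂P) ^ (1 / (m : ℝ))

/-- The noise stability `α^r_m` of `f`, computed from the random vectors `Y = (Y_1, …, Y_n)` (the
augmented data) and `Z = (Z_1, …, Z_n)` (the Gaussian surrogates). -/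
def noiseStability {Ω : Type*} [MeasurableSpace Ω] (P : Measure Ω) {n k d q : ℕ}
    (f : (Fin n → Block k d) → EuclideanSpace ℝ (Fin q))
    (Y Z : Fin n → Ω → Block k d) (r m : ℕ) : ℝ≥0∞ :=
  ⨆ i : Fin n, max
    (momentNorm P m fun ω => ⨆ w ∈ segment ℝ 0 (Y i ω), ENNReal.ofReal
      (flatNorm (blockDeriv r f i (interpolate (fun j => Y j ω) (fun j => Z j ω) i w))))
    (momentNorm P m fun ω => ⨆ w ∈ segment ℝ 0 (Z i ω), ENNReal.ofReal
      (flatNorm (blockDeriv r f i (interpolate (fun j => Y j ω) (fun j => Z j ω) i w))))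

/-- `η^r(h) = ‖∂^r h(0)‖`. -/
def etaSmooth {q : ℕ} (r : ℕ) (h : EuclideanSpace ℝ (Fin q) → ℝ) : ℝ :=
  flatNorm (iteratedFDeriv ℝ r h 0)

/-- `γ^3(h) = sup_v ‖∂^3 h(v)‖`, an element of `[0,∞]`. -/
def gammaSmooth {q : ℕ} (h : EuclideanSpace ℝ (Fin q) → ℝ) : ℝ≥0∞ :=
  ⨆ v, ENNReal.ofReal (flatNorm (iteratedFDeriv ℝ 3 h v))

/-- The class `𝓗` of test functions on `ℝ^q`. -/
def testClass (q : ℕ) : Set (EuclideanSpace ℝ (Fin q) → ℝ) :=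
  {h | TimesDifferentiable 3 h ∧ etaSmooth 1 h ≤ 1 ∧ etaSmooth 2 h ≤ 1 ∧ gammaSmooth h ≤ 1}

/-- `d_𝓗(U, V) = sup_{h ∈ 𝓗} |𝔼 h(U) - 𝔼 h(V)|`, an element of `[0,∞]`. -/
def testDist {Ω : Type*} [MeasurableSpace Ω] (P : Measure Ω) {q : ℕ}
    (U V : Ω → EuclideanSpace ℝ (Fin q)) : ℝ≥0∞ :=
  ⨆ h ∈ testClass q, ENNReal.ofReal |∫ ω, h (U ω) ∂P - ∫ ω, h (V ω) ∂P|

/-- The covariance matrix `Cov(U, V) = (Cov(U_a, V_b))_{a,b}` of two random vectors. -/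
def covMat {Ω ι : Type*} [MeasurableSpace Ω] (P : Measure Ω)
    (U V : Ω → EuclideanSpace ℝ ι) : Matrix ι ι ℝ :=
  Matrix.of fun a b => covariance (fun ω => U ω a) (fun ω => V ω b) P

/-- The transformed observation `φ X`. -/
def transformed {Ω : Type*} {d : ℕ}
    {T : Set (EuclideanSpace ℝ (Fin d) → EuclideanSpace ℝ (Fin d))}
    (φ : Ω → T) (X : Ω → EuclideanSpace ℝ (Fin d)) : Ω → EuclideanSpace ℝ (Fin d) :=
  fun ω => (φ ω).1 (X ω)

/-- The augmented data vector `Φ_i X_i = (φ_{i1} X_i, …, φ_{ik} X_i) ∈ ℝ^{kd}`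
(all indices start at `0`). -/
def augmented {Ω : Type*} {d : ℕ}
    {T : Set (EuclideanSpace ℝ (Fin d) → EuclideanSpace ℝ (Fin d))}
    (φ : ℕ → ℕ → Ω → T) (X : ℕ → Ω → EuclideanSpace ℝ (Fin d)) (k i : ℕ) : Ω → Block k d :=
  fun ω => WithLp.toLp 2 fun jl => transformed (φ i jl.1) (X i) ω jl.2

/-- The smoothness condition on `α r m (n, k) = α^r_m` that controls `λ₂`. -/
def SmoothnessLambda2 (α : ℕ → ℕ → ℕ × ℕ → ℝ) (l : Filter (ℕ × ℕ)) : Prop :=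
  let rate : ℕ × ℕ → ℝ := fun p => 1 / ((p.1 : ℝ) * (p.2 : ℝ) ^ (3 / 2 : ℝ))
  (fun p => α 1 6 p ^ 3) =o[l] rate ∧
  (fun p => α 0 6 p * α 1 6 p * α 2 6 p) =o[l] rate ∧
  (fun p => α 0 6 p ^ 2 * α 3 6 p) =o[l] rate ∧
  (fun p => α 1 4 p * α 2 4 p) =o[l] rate ∧
  (fun p => α 0 4 p * α 3 4 p) =o[l] rate ∧
  (fun p => α 3 2 p) =o[l] rate

/-- The smoothness condition on `α r m (n, k) = α^r_m` that controls `λ₁`. -/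
def SmoothnessLambda1 (α : ℕ → ℕ → ℕ × ℕ → ℝ) (l : Filter (ℕ × ℕ)) : Prop :=
  let rate : ℕ × ℕ → ℝ := fun p => 1 / ((p.1 : ℝ) * (p.2 : ℝ) ^ (1 / 2 : ℝ))
  (fun p => α 0 3 p * α 1 3 p ^ 2) =o[l] rate ∧
  (fun p => α 0 3 p ^ 2 * α 2 3 p) =o[l] rate ∧
  (fun p => α 1 2 p ^ 2) =o[l] rate ∧
  (fun p => α 0 2 p * α 2 2 p) =o[l] rate ∧
  (fun p => α 2 1 p) =o[l] rate

end

/-! The proof is Lindeberg's replacement method with a third-order Taylor expansion. The blocks `Φ_i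
X_i` are exchanged for `Z_i` one at a time, so the difference of expectations telescopes into `n`
terms (`testDist_le`). Each term compares `h ∘ f` at `R + L V` and at `R + L V'`, where `R =
W_i(0)`, `L` embeds block `i`, and `V = Φ_i X_i`, `V' = Z_i` are both independent of `R`.

Both sides are expanded to second order about the same point `R` (`integral_eq_expansion`,
`enorm_integral_sub_integral_le`), and independence factors the expectations. The terms of order
zero and one cancel because the means agree. In every `d × d` block the second moments of `Z_i` are
the cross moments of two distinct augmentations of one observation, so they differ from those of
`Φ_i X_i` only in the `k` diagonal blocks. This defect has Frobenius norm `√k` times a constant, and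
Cauchy-Schwarz against the Hessian of `h ∘ f` yields `√k * lambdaOne`. The remainder is a third
derivative of `h ∘ f` along the segment times `‖V‖ ^ 3`; Hölder with `‖V‖ ^ 3` in `L_2` yields `k ^
(3/2) * lambdaTwo`. For `h` in the test class `∂³h` is bounded, `∂²h` grows linearly and `∂h`
quadratically, which produces exactly the products of noise stabilities in the hypotheses.
Altogether the distance is at most `C n (√k λ₁ + k^{3/2} λ₂)` with `C` independent of `n` and `k`.

Two points need care: the third derivative of `f` need not be continuous, and the suprema in the
noise stability need not be measurable. The remainder is therefore taken in Lagrange form, and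
Hölder is applied to measurable minorants of the suprema (`exists_measurable_le_segmentSup`);
`lintegral` is monotone for arbitrary functions, so bounding the minorants by the noise stability is
legitimate. -/

noncomputable section

set_option maxSynthPendingDepth 3
set_option linter.unusedSectionVars false

/-! ### Taylor's formula with Lagrange remainder and growth of test functions. -/

section Calculus

variable {E F : Type*} [NormedAddCommGroup E] [NormedSpace ℝ E]
  [NormedAddCommGroup F] [NormedSpace ℝ F]

/-- Three times differentiable, in terms of iterated `fderiv`. -/
def ThriceDifferentiable (f : E → F) : Prop :=
  Differentiable ℝ f ∧ Differentiable ℝ (fderiv ℝ f) ∧ Differentiable ℝ (fderiv ℝ (fderiv ℝ f))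

lemma differentiable_iteratedFDeriv_succ_iff (m : ℕ) (f : E → F) :
    Differentiable ℝ (iteratedFDeriv ℝ (m + 1) f) ↔
      Differentiable ℝ (iteratedFDeriv ℝ m (fderiv ℝ f)) := by
  have h : iteratedFDeriv ℝ (m + 1) f =
      (continuousMultilinearCurryRightEquiv' ℝ m E F).symm ∘
        iteratedFDeriv ℝ m (fderiv ℝ f) := by
    ext1 x
    rw [iteratedFDeriv_succ_eq_comp_right]
  rw [h]
  exact LinearIsometryEquiv.comp_differentiable_iff _

lemma differentiable_iteratedFDeriv_zero_iff (f : E → F) :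
    Differentiable ℝ (iteratedFDeriv ℝ 0 f) ↔ Differentiable ℝ f := by
  rw [iteratedFDeriv_zero_eq_comp, LinearIsometryEquiv.comp_differentiable_iff]

lemma TimesDifferentiable.thrice {f : E → F} (h : TimesDifferentiable 3 f) :
    ThriceDifferentiable f := by
  refine ⟨?_, ?_, ?_⟩
  · simpa [differentiable_iteratedFDeriv_zero_iff] using h 0 (by norm_num)
  · simpa [differentiable_iteratedFDeriv_succ_iff, differentiable_iteratedFDeriv_zero_iff]
      using h 1 (by norm_num)
  · simpa [differentiable_iteratedFDeriv_succ_iff, differentiable_iteratedFDeriv_zero_iff]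
      using h 2 (by norm_num)

lemma iteratedFDeriv_three_apply (f : E → F) (x : E) (m : Fin 3 → E) :
    iteratedFDeriv ℝ 3 f x m = fderiv ℝ (fderiv ℝ (fderiv ℝ f)) x (m 0) (m 1) (m 2) := by
  rw [iteratedFDeriv_succ_apply_right, iteratedFDeriv_two_apply]
  rfl

/-- Third-order Taylor formula with Lagrange remainder, without continuity of the
third derivative. -/
lemma exists_taylor_three {v v1 v2 v3 : ℝ → ℝ} (h0 : ∀ t, HasDerivAt v (v1 t) t)
    (h1 : ∀ t, HasDerivAt v1 (v2 t) t) (h2 : ∀ t, HasDerivAt v2 (v3 t) t) :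
    ∃ ξ ∈ Set.Ioo (0 : ℝ) 1, v 1 - v 0 - v1 0 - v2 0 / 2 = v3 ξ / 6 := by
  -- `K` is chosen so that `g` vanishes at `0` as well as at `1`. The derivative of `g` telescopes
  -- to `(K - v3 t) (1 - t)² / 2`, so Rolle's theorem forces `v3 ξ = K`.
  set K : ℝ := 6 * (v 1 - v 0 - v1 0 - v2 0 / 2) with hK
  set g : ℝ → ℝ := fun t =>
    v 1 - v t - v1 t * (1 - t) - v2 t * (1 - t) ^ 2 / 2 - K * (1 - t) ^ 3 / 6 with hg
  have hd : ∀ t, HasDerivAt g ((K - v3 t) * (1 - t) ^ 2 / 2) t := by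
    intro t
    have hl : HasDerivAt (fun t : ℝ => 1 - t) (-1) t := by
      simpa using (hasDerivAt_id t).const_sub 1
    have := ((((h0 t).const_sub (v 1)).sub ((h1 t).mul hl)).sub
      (((h2 t).mul (hl.pow 2)).div_const 2)).sub (((hl.pow 3).const_mul K).div_const 6)
    refine this.congr_deriv ?_
    simp only [Nat.cast_ofNat, Pi.pow_apply]
    ring
  have hgc : ContinuousOn g (Set.Icc 0 1) := fun t _ => (hd t).continuousAt.continuousWithinAt
  obtain ⟨ξ, hξ, hz⟩ := exists_hasDerivAt_eq_zero (f := g) zero_lt_one hgc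
    (by simp only [hg, hK]; ring) (fun t _ => hd t)
  refine ⟨ξ, hξ, ?_⟩
  have h3 : (1 - ξ) ^ 2 ≠ 0 := pow_ne_zero _ (by linarith [hξ.2])
  have : K - v3 ξ = 0 := by
    rcases mul_eq_zero.1 (div_eq_zero_iff.1 hz |>.resolve_right two_ne_zero) with h | h
    · exact h
    · exact absurd h h3
  linarith

lemma hasDerivAt_line {f : E → F} (hf : Differentiable ℝ f) (y : E) (t : ℝ) :
    HasDerivAt (fun t : ℝ => f (t • y)) (fderiv ℝ f (t • y) y) t := by
  have h : HasDerivAt (fun t : ℝ => t • y) y t := by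
    simpa using (hasDerivAt_id t).smul_const y
  exact (hf (t • y)).hasFDerivAt.comp_hasDerivAt t h

lemma hasDerivAt_line₁ {f : E → F} (hf : ThriceDifferentiable f) (y : E) (t : ℝ) :
    HasDerivAt (fun t : ℝ => fderiv ℝ f (t • y) y) (fderiv ℝ (fderiv ℝ f) (t • y) y y) t := by
  have := (hasDerivAt_line hf.2.1 y t).clm_apply (hasDerivAt_const t y)
  simpa using this

lemma hasDerivAt_line₂ {f : E → F} (hf : ThriceDifferentiable f) (y : E) (t : ℝ) :
    HasDerivAt (fun t : ℝ => fderiv ℝ (fderiv ℝ f) (t • y) y y)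
      (fderiv ℝ (fderiv ℝ (fderiv ℝ f)) (t • y) y y y) t := by
  have := ((hasDerivAt_line hf.2.2 y t).clm_apply (hasDerivAt_const t y)).clm_apply
    (hasDerivAt_const t y)
  simpa using this

/-- Growth bounds shared by all functions of the test class. -/
structure TestBounds (h : F → ℝ) : Prop where
  thrice : ThriceDifferentiable h
  norm_le : ∀ v, ‖h v‖ ≤ ‖h 0‖ + (‖v‖ + ‖v‖ ^ 2 + ‖v‖ ^ 3)
  norm_le₁ : ∀ v, ‖fderiv ℝ h v‖ ≤ 1 + ‖v‖ + ‖v‖ ^ 2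
  norm_le₂ : ∀ v, ‖fderiv ℝ (fderiv ℝ h) v‖ ≤ 1 + ‖v‖
  norm_le₃ : ∀ v, ‖fderiv ℝ (fderiv ℝ (fderiv ℝ h)) v‖ ≤ 1

lemma norm_sub_le_of_fderiv_bound {g : E → F} (hg : Differentiable ℝ g) (v : E) {C : ℝ}
    (hC : ∀ x, ‖x‖ ≤ ‖v‖ → ‖fderiv ℝ g x‖ ≤ C) : ‖g v‖ ≤ ‖g 0‖ + C * ‖v‖ := by
  have h := (convex_closedBall (0 : E) ‖v‖).norm_image_sub_le_of_norm_fderiv_le (𝕜 := ℝ)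
    (f := g) (C := C) (fun x _ => hg x) (fun x hx => hC x (by simpa using hx))
    (x := 0) (y := v) (by simp) (by simp)
  rw [sub_zero] at h
  calc ‖g v‖ = ‖g 0 + (g v - g 0)‖ := by congr 1; abel
    _ ≤ ‖g 0‖ + ‖g v - g 0‖ := norm_add_le _ _
    _ ≤ _ := by gcongr

/-- The bound on the third derivative is propagated outward from the origin by the mean value
inequality, three times, each time gaining one power of `‖v‖`. -/
lemma TestBounds.of_bounds {h : F → ℝ} (ht : ThriceDifferentiable h)
    (h1 : ‖fderiv ℝ h 0‖ ≤ 1) (h2 : ‖fderiv ℝ (fderiv ℝ h) 0‖ ≤ 1)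
    (h3 : ∀ v, ‖fderiv ℝ (fderiv ℝ (fderiv ℝ h)) v‖ ≤ 1) : TestBounds h := by
  have b2 : ∀ v, ‖fderiv ℝ (fderiv ℝ h) v‖ ≤ 1 + ‖v‖ := fun v => by
    have := norm_sub_le_of_fderiv_bound ht.2.2 v (C := 1) (fun x _ => h3 x)
    linarith
  have b1 : ∀ v, ‖fderiv ℝ h v‖ ≤ 1 + ‖v‖ + ‖v‖ ^ 2 := fun v => by
    have := norm_sub_le_of_fderiv_bound ht.2.1 v (C := 1 + ‖v‖)
      (fun x hx => (b2 x).trans (by linarith))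
    nlinarith
  refine ⟨ht, fun v => ?_, b1, b2, h3⟩
  have := norm_sub_le_of_fderiv_bound ht.1 v (C := 1 + ‖v‖ + ‖v‖ ^ 2)
      (fun x hx => (b1 x).trans (by gcongr))
  nlinarith

/-- Third-order Taylor bound for `h ∘ u` along a curve `u`. -/
lemma TestBounds.exists_taylor_bound {h : F → ℝ} (hh : TestBounds h) {u u1 u2 u3 : ℝ → F}
    (d0 : ∀ t, HasDerivAt u (u1 t) t) (d1 : ∀ t, HasDerivAt u1 (u2 t) t)
    (d2 : ∀ t, HasDerivAt u2 (u3 t) t) :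
    ∃ ξ ∈ Set.Ioo (0 : ℝ) 1,
      |h (u 1) - h (u 0) - fderiv ℝ h (u 0) (u1 0) -
        (fderiv ℝ (fderiv ℝ h) (u 0) (u1 0) (u1 0) + fderiv ℝ h (u 0) (u2 0)) / 2| ≤
      ‖u1 ξ‖ ^ 3 + (1 + ‖u ξ‖) * ‖u1 ξ‖ * ‖u2 ξ‖ + (1 + ‖u ξ‖ + ‖u ξ‖ ^ 2) * ‖u3 ξ‖ := by
  obtain ⟨e0, e1, e2⟩ := hh.thrice
  have c0 : ∀ t, HasDerivAt (fun t => h (u t)) (fderiv ℝ h (u t) (u1 t)) t := fun t =>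
    (e0 (u t)).hasFDerivAt.comp_hasDerivAt t (d0 t)
  have c1' : ∀ t, HasDerivAt (fun t => fderiv ℝ h (u t)) (fderiv ℝ (fderiv ℝ h) (u t) (u1 t)) t :=
    fun t => (e1 (u t)).hasFDerivAt.comp_hasDerivAt t (d0 t)
  have c2' : ∀ t, HasDerivAt (fun t => fderiv ℝ (fderiv ℝ h) (u t))
      (fderiv ℝ (fderiv ℝ (fderiv ℝ h)) (u t) (u1 t)) t :=
    fun t => (e2 (u t)).hasFDerivAt.comp_hasDerivAt t (d0 t)
  have c1 := fun t => (c1' t).clm_apply (d1 t)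
  -- The third derivative of `h ∘ u` contains three terms pairing `u1` with `u2`, in both orders of
  -- the arguments. Each is bounded separately, so symmetry is not needed, and the Taylor factor
  -- `1/6` absorbs the multiplicity.
  have c2 := fun t => (((c2' t).clm_apply (d1 t)).clm_apply (d1 t)).add ((c1' t).clm_apply (d2 t))
  obtain ⟨ξ, hξ, heq⟩ := exists_taylor_three c0 c1 c2
  refine ⟨ξ, hξ, ?_⟩
  have hb2 := hh.norm_le₂ (u ξ)
  have hb1 := hh.norm_le₁ (u ξ)
  have hb3 := hh.norm_le₃ (u ξ)
  have p2 : ∀ a b, ‖fderiv ℝ (fderiv ℝ h) (u ξ) a b‖ ≤ (1 + ‖u ξ‖) * ‖a‖ * ‖b‖ := fun a b =>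
    (ContinuousLinearMap.le_opNorm₂ _ a b).trans (by gcongr)
  have p1 : ∀ a, ‖fderiv ℝ h (u ξ) a‖ ≤ (1 + ‖u ξ‖ + ‖u ξ‖ ^ 2) * ‖a‖ := fun a =>
    (ContinuousLinearMap.le_opNorm _ a).trans (by gcongr)
  have p3 : ‖fderiv ℝ (fderiv ℝ (fderiv ℝ h)) (u ξ) (u1 ξ) (u1 ξ) (u1 ξ)‖ ≤ ‖u1 ξ‖ ^ 3 := by
    have := ContinuousLinearMap.le_opNorm₂ (fderiv ℝ (fderiv ℝ (fderiv ℝ h)) (u ξ) (u1 ξ))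
      (u1 ξ) (u1 ξ)
    have h' := (ContinuousLinearMap.le_opNorm (fderiv ℝ (fderiv ℝ (fderiv ℝ h)) (u ξ)) (u1 ξ))
    calc _ ≤ _ := this
      _ ≤ (1 * ‖u1 ξ‖) * ‖u1 ξ‖ * ‖u1 ξ‖ := by
        gcongr
        exact h'.trans (by gcongr)
      _ = _ := by ring
  have q1 := p2 (u1 ξ) (u2 ξ)
  have q2 := p2 (u2 ξ) (u1 ξ)
  have q3 := p1 (u3 ξ)
  have n1 : 0 ≤ ‖u1 ξ‖ ^ 3 := by positivity
  have n2 : 0 ≤ (1 + ‖u ξ‖) * ‖u1 ξ‖ * ‖u2 ξ‖ := by positivity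
  have n3 : 0 ≤ (1 + ‖u ξ‖ + ‖u ξ‖ ^ 2) * ‖u3 ξ‖ := by positivity
  have n4 : (1 + ‖u ξ‖) * ‖u2 ξ‖ * ‖u1 ξ‖ = (1 + ‖u ξ‖) * ‖u1 ξ‖ * ‖u2 ξ‖ := by ring
  rw [n4] at q2
  simp only [Real.norm_eq_abs] at q1 q2 q3 p3
  refine (le_of_eq (congrArg abs heq)).trans ?_
  simp only [add_apply]
  rw [abs_le] at q1 q2 q3 p3 ⊢
  constructor <;> linarith [q1.1, q1.2, q2.1, q2.2, q3.1, q3.2, p3.1, p3.2]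

end Calculus

/-! ### Frobenius norms of derivatives dominate their values on vectors. -/

section FlatNorm

variable {ι F : Type*} [Fintype ι] [DecidableEq ι] [NormedAddCommGroup F] [NormedSpace ℝ F]

lemma flatNorm_nonneg {r : ℕ}
    (T : ContinuousMultilinearMap ℝ (fun _ : Fin r => EuclideanSpace ℝ ι) F) : 0 ≤ flatNorm T :=
  Real.sqrt_nonneg _

lemma flatNorm_sq {r : ℕ}
    (T : ContinuousMultilinearMap ℝ (fun _ : Fin r => EuclideanSpace ℝ ι) F) :
    flatNorm T ^ 2 = ∑ s : Fin r → ι, ‖T fun a => EuclideanSpace.single (s a) (1 : ℝ)‖ ^ 2 :=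
  Real.sq_sqrt (by positivity)

lemma euclideanSpace_eq_sum_single (x : EuclideanSpace ℝ ι) :
    x = ∑ a, x a • EuclideanSpace.single a (1 : ℝ) := by
  ext b
  simp [Pi.single_apply]

/-- Multilinear expansion in the standard basis, then Cauchy-Schwarz over multi-indices; the sum of
the squared coefficients factors into `∏ ‖m a‖ ^ 2`. -/
lemma norm_apply_le_flatNorm {r : ℕ}
    (T : ContinuousMultilinearMap ℝ (fun _ : Fin r => EuclideanSpace ℝ ι) F)
    (m : Fin r → EuclideanSpace ℝ ι) : ‖T m‖ ≤ flatNorm T * ∏ a, ‖m a‖ := by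
  have h1 : T m = ∑ s : Fin r → ι,
      (∏ a, m a (s a)) • T fun a => EuclideanSpace.single (s a) (1 : ℝ) := by
    conv_lhs => rw [show m = fun a => ∑ b, m a b • EuclideanSpace.single b (1 : ℝ) from
      funext fun a => euclideanSpace_eq_sum_single (m a)]
    rw [ContinuousMultilinearMap.map_sum]
    refine Finset.sum_congr rfl fun s _ => ?_
    rw [ContinuousMultilinearMap.map_smul_univ]
  have h2 : ∏ a, ‖m a‖ = √(∑ s : Fin r → ι, ‖∏ a, m a (s a)‖ ^ 2) := by
    have : ∑ s : Fin r → ι, ‖∏ a, m a (s a)‖ ^ 2 = (∏ a, ‖m a‖) ^ 2 := by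
      rw [← Finset.prod_pow]
      simp_rw [EuclideanSpace.norm_sq_eq, norm_prod, ← Finset.prod_pow]
      rw [Finset.prod_univ_sum, Fintype.piFinset_univ]
    rw [this, Real.sqrt_sq (by positivity)]
  rw [h1, h2]
  calc _ ≤ ∑ s : Fin r → ι, ‖∏ a, m a (s a)‖ *
        ‖T fun a => EuclideanSpace.single (s a) (1 : ℝ)‖ :=
        norm_sum_le_of_le _ fun s _ => by rw [norm_smul]
    _ ≤ _ := Real.sum_mul_le_sqrt_mul_sqrt _ _ _
    _ = _ := mul_comm _ _

lemma flatNorm_iteratedFDeriv_zero (f : EuclideanSpace ℝ ι → F) (x : EuclideanSpace ℝ ι) :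
    flatNorm (iteratedFDeriv ℝ 0 f x) = ‖f x‖ := by
  simp [flatNorm]

lemma flatNorm_iteratedFDeriv_one_sq (f : EuclideanSpace ℝ ι → F) (x : EuclideanSpace ℝ ι) :
    flatNorm (iteratedFDeriv ℝ 1 f x) ^ 2 =
      ∑ a, ‖fderiv ℝ f x (EuclideanSpace.single a 1)‖ ^ 2 := by
  rw [flatNorm_sq]
  simp only [iteratedFDeriv_one_apply]
  exact Fintype.sum_equiv (Equiv.funUnique (Fin 1) ι) _ _ fun s => rfl

lemma flatNorm_iteratedFDeriv_two_sq (f : EuclideanSpace ℝ ι → F) (x : EuclideanSpace ℝ ι) :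
    flatNorm (iteratedFDeriv ℝ 2 f x) ^ 2 =
      ∑ a, ∑ b, ‖fderiv ℝ (fderiv ℝ f) x (EuclideanSpace.single a 1)
        (EuclideanSpace.single b 1)‖ ^ 2 := by
  rw [flatNorm_sq, ← Fintype.sum_prod_type']
  simp only [iteratedFDeriv_two_apply]
  exact Fintype.sum_equiv (finTwoArrowEquiv ι) _ _ fun s => rfl

lemma norm_fderiv_apply_le_flatNorm (f : EuclideanSpace ℝ ι → F) (x y : EuclideanSpace ℝ ι) :
    ‖fderiv ℝ f x y‖ ≤ flatNorm (iteratedFDeriv ℝ 1 f x) * ‖y‖ := by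
  simpa using norm_apply_le_flatNorm (iteratedFDeriv ℝ 1 f x) fun _ => y

lemma norm_fderiv₂_apply_le_flatNorm (f : EuclideanSpace ℝ ι → F)
    (x y z : EuclideanSpace ℝ ι) : ‖fderiv ℝ (fderiv ℝ f) x y z‖ ≤
      flatNorm (iteratedFDeriv ℝ 2 f x) * ‖y‖ * ‖z‖ := by
  simpa [iteratedFDeriv_two_apply, mul_assoc] using
    norm_apply_le_flatNorm (iteratedFDeriv ℝ 2 f x) ![y, z]

lemma norm_fderiv₃_apply_le_flatNorm (f : EuclideanSpace ℝ ι → F)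
    (x y z w : EuclideanSpace ℝ ι) : ‖fderiv ℝ (fderiv ℝ (fderiv ℝ f)) x y z w‖ ≤
      flatNorm (iteratedFDeriv ℝ 3 f x) * ‖y‖ * ‖z‖ * ‖w‖ := by
  simpa [iteratedFDeriv_three_apply, Fin.prod_univ_three, mul_assoc] using
    norm_apply_le_flatNorm (iteratedFDeriv ℝ 3 f x) ![y, z, w]

end FlatNorm

lemma testBounds_of_mem_testClass {q : ℕ} {h : EuclideanSpace ℝ (Fin q) → ℝ}
    (hh : h ∈ testClass q) : TestBounds h := by
  obtain ⟨ht, h1, h2, h3⟩ := hh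
  have h3' : ∀ v, flatNorm (iteratedFDeriv ℝ 3 h v) ≤ 1 := fun v => by
    have := (le_iSup (fun v => ENNReal.ofReal (flatNorm (iteratedFDeriv ℝ 3 h v))) v).trans h3
    rwa [ENNReal.ofReal_le_one] at this
  refine TestBounds.of_bounds ht.thrice ?_ ?_ fun v => ?_
  · refine ContinuousLinearMap.opNorm_le_bound _ zero_le_one fun y => ?_
    exact (norm_fderiv_apply_le_flatNorm h 0 y).trans
      (mul_le_mul_of_nonneg_right h1 (norm_nonneg _))
  · refine ContinuousLinearMap.opNorm_le_bound₂ _ zero_le_one fun y z => ?_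
    refine (norm_fderiv₂_apply_le_flatNorm h 0 y z).trans ?_
    gcongr
    exact h2
  · refine ContinuousLinearMap.opNorm_le_bound _ zero_le_one fun y => ?_
    refine ContinuousLinearMap.opNorm_le_bound₂ _ (by positivity) fun z w => ?_
    refine (norm_fderiv₃_apply_le_flatNorm h v y z w).trans ?_
    gcongr
    exact h3' v

/-! ### Derivatives along an affine embedding of one block. -/

section AffineComp

variable {B A F : Type*} [NormedAddCommGroup A] [NormedSpace ℝ A]
  [NormedAddCommGroup B] [NormedSpace ℝ B] [NormedAddCommGroup F] [NormedSpace ℝ F]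

lemma hasFDerivAt_comp_affine {f : A → F} (hf : Differentiable ℝ f) (c : A) (L : B →L[ℝ] A)
    (w : B) : HasFDerivAt (fun w => f (c + L w)) ((fderiv ℝ f (c + L w)).comp L) w :=
  (hf (c + L w)).hasFDerivAt.comp w (L.hasFDerivAt.const_add c)

/-- Expressing the derivative through the fixed linear map `precomp F L` allows the chain rule to be
applied to it again. -/
lemma fderiv_comp_affine {f : A → F} (hf : Differentiable ℝ f) (c : A) (L : B →L[ℝ] A) :
    fderiv ℝ (fun w => f (c + L w)) =
      fun w => ContinuousLinearMap.precomp F L (fderiv ℝ f (c + L w)) :=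
  funext fun w => (hasFDerivAt_comp_affine hf c L w).fderiv

lemma fderiv₂_comp_affine {f : A → F} (hf : ThriceDifferentiable f) (c : A) (L : B →L[ℝ] A) :
    fderiv ℝ (fderiv ℝ (fun w => f (c + L w))) =
      fun w => (ContinuousLinearMap.precomp F L).comp
        ((fderiv ℝ (fderiv ℝ f) (c + L w)).comp L) := by
  rw [fderiv_comp_affine hf.1]
  exact funext fun w => ((ContinuousLinearMap.precomp F L).hasFDerivAt.comp w
    (hasFDerivAt_comp_affine hf.2.1 c L w)).fderiv

lemma ThriceDifferentiable.comp_affine {f : A → F} (hf : ThriceDifferentiable f) (c : A)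
    (L : B →L[ℝ] A) : ThriceDifferentiable fun w => f (c + L w) := by
  refine ⟨fun w => (hasFDerivAt_comp_affine hf.1 c L w).differentiableAt, ?_, ?_⟩
  · rw [fderiv_comp_affine hf.1]
    exact fun w => ((ContinuousLinearMap.precomp F L).hasFDerivAt.comp w
      (hasFDerivAt_comp_affine hf.2.1 c L w)).differentiableAt
  · rw [fderiv₂_comp_affine hf]
    have h : Differentiable ℝ fun w => fderiv ℝ (fderiv ℝ f) (c + L w) :=
      fun w => (hasFDerivAt_comp_affine hf.2.2 c L w).differentiableAt
    exact (differentiable_const _).clm_comp (h.clm_comp (differentiable_const _))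

/-- Joint continuity makes derivatives at random points in random directions measurable. It is at
hand only up to order two. -/
lemma ThriceDifferentiable.continuous_fderiv_apply {f : A → F} (hf : ThriceDifferentiable f) :
    Continuous fun p : A × A => fderiv ℝ f p.1 p.2 :=
  (hf.2.1.continuous.comp continuous_fst).clm_apply continuous_snd

lemma ThriceDifferentiable.continuous_fderiv₂_apply {f : A → F} (hf : ThriceDifferentiable f) :
    Continuous fun p : A × A × A => fderiv ℝ (fderiv ℝ f) p.1 p.2.1 p.2.2 :=
  ((hf.2.2.continuous.comp continuous_fst).clm_apply continuous_snd.fst).clm_apply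
    continuous_snd.snd

end AffineComp

/-! ### Measurable suprema along random paths. -/

section MeasurableSup

variable {Ω E : Type*} [MeasurableSpace Ω] [NormedAddCommGroup E] [MeasurableSpace E]
  [OpensMeasurableSpace E]

/-- For continuous paths the supremum over rational times is measurable and already dominates every
time. The last clause says that `G` is the least such bound. -/
lemma exists_measurable_sup_path (p : Ω → ℝ → E) (hm : ∀ t, Measurable fun ω => p ω t)
    (hc : ∀ ω, Continuous (p ω)) :
    ∃ G : Ω → ℝ≥0∞, Measurable G ∧ (∀ ω, ∀ t ∈ Set.Icc (0 : ℝ) 1, ‖p ω t‖ₑ ≤ G ω) ∧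
      ∀ ω C, (∀ t ∈ Set.Icc (0 : ℝ) 1, ‖p ω t‖ₑ ≤ C) → G ω ≤ C := by
  -- Clamping to `[0, 1]` lets all rationals serve as index set, so density of `ℚ` in `ℝ` is enough.
  let c : ℝ → ℝ := fun t => Set.projIcc (0 : ℝ) 1 zero_le_one t
  have hcc : Continuous c := continuous_subtype_val.comp continuous_projIcc
  refine ⟨fun ω => ⨆ t : ℚ, ‖p ω (c t)‖ₑ, Measurable.iSup fun t => (hm _).enorm, ?_, ?_⟩
  · intro ω t ht
    have hcl : IsClosed {s : ℝ | ‖p ω (c s)‖ₑ ≤ ⨆ t : ℚ, ‖p ω (c t)‖ₑ} :=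
      isClosed_le (((hc ω).comp hcc).enorm) continuous_const
    have := Rat.denseRange_cast.induction_on (p := fun s : ℝ =>
      ‖p ω (c s)‖ₑ ≤ ⨆ t : ℚ, ‖p ω (c t)‖ₑ) t hcl
      (fun a => le_iSup (fun t : ℚ => ‖p ω (c t)‖ₑ) a)
    have hct : c t = t := by simp [c, Set.projIcc_of_mem _ ht]
    rwa [hct] at this
  · exact fun ω C hC => iSup_le fun t => hC _ (Set.projIcc (0 : ℝ) 1 zero_le_one (t : ℝ)).2

/-- A derivative that may be discontinuous is still a limit of difference quotients, whose suprema
are measurable by continuity of `p`. By the mean value inequality these quotients never exceed a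
bound on the derivative. The right endpoint is excluded because the quotients look to the right;
Lagrange points lie in the open interval anyway. -/
lemma exists_measurable_sup_deriv [NormedSpace ℝ E] [BorelSpace E] [SecondCountableTopology E]
    (p p' : Ω → ℝ → E)
    (hm : ∀ t, Measurable fun ω => p ω t) (hd : ∀ ω t, HasDerivAt (p ω) (p' ω t) t) :
    ∃ G : Ω → ℝ≥0∞, Measurable G ∧ (∀ ω, ∀ t ∈ Set.Ioo (0 : ℝ) 1, ‖p' ω t‖ₑ ≤ G ω) ∧
      ∀ ω C, (∀ t ∈ Set.Icc (0 : ℝ) 1, ‖p' ω t‖ₑ ≤ C) → G ω ≤ C := by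
  let c : ℝ → ℝ := fun t => Set.projIcc (0 : ℝ) 1 zero_le_one t
  have hcc : Continuous c := continuous_subtype_val.comp continuous_projIcc
  have hpc : ∀ ω, Continuous (p ω) := fun ω =>
    continuous_iff_continuousAt.2 fun t => (hd ω t).continuousAt
  let δ : ℕ → ℝ := fun m => 1 / ((m : ℝ) + 1)
  have hδ : ∀ m, 0 < δ m := fun m => Nat.one_div_pos_of_nat
  have key : ∀ m : ℕ, ∃ G : Ω → ℝ≥0∞, Measurable G ∧ (∀ ω, ∀ t ∈ Set.Icc (0 : ℝ) 1,
      ‖(δ m)⁻¹ • (p ω (c (t + δ m)) - p ω (c t))‖ₑ ≤ G ω) ∧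
      ∀ ω C, (∀ t ∈ Set.Icc (0 : ℝ) 1,
        ‖(δ m)⁻¹ • (p ω (c (t + δ m)) - p ω (c t))‖ₑ ≤ C) → G ω ≤ C := fun m =>
    exists_measurable_sup_path (fun ω t => (δ m)⁻¹ • (p ω (c (t + δ m)) - p ω (c t)))
      (fun t => ((hm _).sub (hm _)).const_smul _)
      (fun ω => (((hpc ω).comp (hcc.comp (continuous_id.add continuous_const))).sub
        ((hpc ω).comp hcc)).const_smul _)
  choose G hGm hG1 hG2 using key
  refine ⟨fun ω => ⨆ m, G m ω, Measurable.iSup hGm, ?_, ?_⟩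
  · intro ω t ht
    have hδ0 : Tendsto δ atTop (𝓝[>] 0) :=
      tendsto_nhdsWithin_iff.2 ⟨tendsto_one_div_add_atTop_nhds_zero_nat,
        Eventually.of_forall hδ⟩
    have h1 := ((hd ω t).tendsto_slope_zero_right.comp hδ0).enorm
    refine le_of_tendsto h1 ?_
    have h2 : ∀ᶠ m in atTop, δ m < 1 - t :=
      tendsto_one_div_add_atTop_nhds_zero_nat.eventually_lt_const (by linarith [ht.2])
    filter_upwards [h2] with m hm'
    have e1 : c t = t := by
      simp [c, Set.projIcc_of_mem zero_le_one (Set.mem_Icc_of_Ioo ht)]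
    have e2 : c (t + δ m) = t + δ m := by
      have : t + δ m ∈ Set.Icc (0 : ℝ) 1 := ⟨by linarith [ht.1, hδ m], by linarith⟩
      simp [c, Set.projIcc_of_mem zero_le_one this]
    have h3 := hG1 m ω t (Set.mem_Icc_of_Ioo ht)
    rw [e1, e2] at h3
    exact h3.trans (le_iSup (fun m => G m ω) m)
  · intro ω C hC
    refine iSup_le fun m => hG2 m ω C fun t _ => ?_
    rcases eq_or_ne C ∞ with rfl | hCt
    · exact le_top
    have hb : ∀ x ∈ Set.Icc (0 : ℝ) 1, ‖p' ω x‖ ≤ C.toReal := fun x hx => by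
      have := (ENNReal.toReal_le_toReal (by simp) hCt).2 (hC x hx)
      rwa [toReal_enorm] at this
    have h1 := Convex.norm_image_sub_le_of_norm_hasDerivWithin_le (f := p ω) (f' := p' ω)
      (fun x _ => (hd ω x).hasDerivWithinAt) hb (convex_Icc 0 1)
      (x := c t) (y := c (t + δ m)) (Subtype.prop _) (Subtype.prop _)
    have h2 : ‖c (t + δ m) - c t‖ ≤ δ m := by
      have := Set.abs_projIcc_sub_projIcc (a := (0 : ℝ)) (b := 1) (c := t + δ m) (d := t)
        zero_le_one
      rwa [add_sub_cancel_left, abs_of_pos (hδ m)] at this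
    have h3 : ‖(δ m)⁻¹ • (p ω (c (t + δ m)) - p ω (c t))‖ ≤ C.toReal := by
      rw [norm_smul, norm_inv, Real.norm_of_nonneg (hδ m).le, inv_mul_le_iff₀ (hδ m), mul_comm]
      exact h1.trans (by gcongr)
    rw [← ofReal_norm]
    exact ENNReal.ofReal_le_of_le_toReal h3

end MeasurableSup

/-! ### Hölder estimates and the rates `λ₁`, `λ₂`. -/

section Moments

variable {Ω : Type*} [MeasurableSpace Ω] {P : Measure Ω}

lemma momentNorm_mono {m : ℕ} {S T : Ω → ℝ≥0∞} (h : ∀ ω, S ω ≤ T ω) :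
    momentNorm P m S ≤ momentNorm P m T := by
  unfold momentNorm
  gcongr with ω
  exact h ω

/-- Hölder's inequality for a finite product. -/
lemma lintegral_prod_le_prod_momentNorm {N : ℕ} (m : Fin N → ℕ) (hm : ∀ i, m i ≠ 0)
    (hs : ∑ i, (1 / (m i : ℝ)) = 1) (S : Fin N → Ω → ℝ≥0∞) (hS : ∀ i, Measurable (S i)) :
    ∫⁻ ω, ∏ i, S i ω ∂P ≤ ∏ i, momentNorm P (m i) (S i) := by
  have h := ENNReal.lintegral_prod_norm_pow_le (μ := P) Finset.univ
    (f := fun i ω => S i ω ^ m i) (fun i _ => ((hS i).pow_const _).aemeasurable)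
    (p := fun i => 1 / (m i : ℝ)) hs (fun i _ => by positivity)
  refine le_trans (le_of_eq ?_) h
  refine lintegral_congr fun ω => Finset.prod_congr rfl fun i _ => ?_
  rw [← ENNReal.rpow_natCast, ← ENNReal.rpow_mul, mul_one_div_cancel, ENNReal.rpow_one]
  exact_mod_cast hm i

lemma lintegral_eq_momentNorm_one (a : Ω → ℝ≥0∞) : ∫⁻ ω, a ω ∂P = momentNorm P 1 a := by
  simp [momentNorm]

lemma lintegral_mul_le_momentNorm {a b : Ω → ℝ≥0∞} (ha : Measurable a) (hb : Measurable b)  :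
    ∫⁻ ω, a ω * b ω ∂P ≤ momentNorm P 2 a * momentNorm P 2 b := by
  have := lintegral_prod_le_prod_momentNorm (P := P) ![2, 2] (by simp [Fin.forall_fin_two])
    (by norm_num [Fin.sum_univ_succ]) ![a, b] (by simp [Fin.forall_fin_two, ha, hb])
  simpa [Fin.prod_univ_succ] using this

lemma lintegral_mul₃_le_momentNorm {a b c : Ω → ℝ≥0∞} (ha : Measurable a) (hb : Measurable b)
    (hc : Measurable c) : ∫⁻ ω, a ω * b ω * c ω ∂P ≤
      momentNorm P 3 a * momentNorm P 3 b * momentNorm P 3 c := by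
  have := lintegral_prod_le_prod_momentNorm (P := P) ![3, 3, 3] (by simp [Fin.forall_fin_succ])
    (by norm_num [Fin.sum_univ_succ]) ![a, b, c] (by simp [Fin.forall_fin_succ, ha, hb, hc])
  simpa [Fin.prod_univ_succ, mul_assoc] using this

lemma lintegral_mul_mul_le_momentNorm {a b v : Ω → ℝ≥0∞} (ha : Measurable a) (hb : Measurable b)
    (hv : Measurable v) : ∫⁻ ω, a ω * b ω * v ω ∂P ≤
      momentNorm P 4 a * momentNorm P 4 b * momentNorm P 2 v := by
  have := lintegral_prod_le_prod_momentNorm (P := P) ![4, 4, 2] (by simp [Fin.forall_fin_succ])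
    (by norm_num [Fin.sum_univ_succ]) ![a, b, v] (by simp [Fin.forall_fin_succ, ha, hb, hv])
  simpa [Fin.prod_univ_succ, mul_assoc] using this

lemma lintegral_mul₃_mul_le_momentNorm {a b c v : Ω → ℝ≥0∞} (ha : Measurable a)
    (hb : Measurable b) (hc : Measurable c) (hv : Measurable v) :
    ∫⁻ ω, a ω * b ω * c ω * v ω ∂P ≤
      momentNorm P 6 a * momentNorm P 6 b * momentNorm P 6 c * momentNorm P 2 v := by
  have := lintegral_prod_le_prod_momentNorm (P := P) ![6, 6, 6, 2]
    (by simp [Fin.forall_fin_succ])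
    (by norm_num [Fin.sum_univ_succ]) ![a, b, c, v] (by simp [Fin.forall_fin_succ, ha, hb, hc, hv])
  simpa [Fin.prod_univ_succ, mul_assoc] using this

/-- Uses `S ^ m ≤ 1 + S ^ 6`; only the constant has to be measurable for the integral to split. For
`m = 0` the outer exponent is `1 / 0 = 0`. -/
lemma momentNorm_ne_top_of_le_six [IsFiniteMeasure P] {S : Ω → ℝ≥0∞} {m : ℕ} (hm : m ≤ 6)
    (h : momentNorm P 6 S ≠ ∞) : momentNorm P m S ≠ ∞ := by
  have h6 : ∫⁻ ω, S ω ^ 6 ∂P ≠ ∞ := by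
    intro ht
    apply h
    rw [momentNorm, ht, ENNReal.top_rpow_of_pos (by norm_num)]
  refine ENNReal.rpow_ne_top_of_nonneg (by positivity) (ne_top_of_le_ne_top ?_
    (lintegral_mono (g := fun ω => 1 + S ω ^ 6) fun ω => ?_))
  · rw [lintegral_add_left measurable_const]
    simp [h6]
  · rcases le_total (S ω) 1 with h1 | h1
    · exact (pow_le_one₀ zero_le h1).trans le_self_add
    · exact (pow_le_pow_right₀ h1 hm).trans le_add_self

/-- The rate `λ₂` of the third-order remainder. -/
def lambdaTwo (A : ℕ → ℕ → ℝ≥0∞) : ℝ≥0∞ :=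
  A 1 6 ^ 3 + A 0 6 * A 1 6 * A 2 6 + A 0 6 ^ 2 * A 3 6 + A 1 4 * A 2 4 + A 0 4 * A 3 4 + A 3 2

/-- The rate `λ₁` of the second-order term. -/
def lambdaOne (A : ℕ → ℕ → ℝ≥0∞) : ℝ≥0∞ :=
  A 0 3 * A 1 3 ^ 2 + A 0 3 ^ 2 * A 2 3 + A 1 2 ^ 2 + A 0 2 * A 2 2 + A 2 1

/-- The product splits into six monomials. Since `v` is placed in `L_2`, three, two or one remaining
factors take the exponents `6`, `4` or `2`. -/
lemma lintegral_le_lambdaTwo {A : ℕ → ℕ → ℝ≥0∞} {a : ℕ → Ω → ℝ≥0∞} {v : Ω → ℝ≥0∞}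
    (ha : ∀ r ≤ 3, Measurable (a r)) (hv : Measurable v)
    (hA : ∀ r ≤ 3, ∀ m, momentNorm P m (a r) ≤ A r m) :
    ∫⁻ ω, (a 1 ω ^ 3 + (1 + a 0 ω) * a 1 ω * a 2 ω + (1 + a 0 ω + a 0 ω ^ 2) * a 3 ω) * v ω ∂P ≤
      lambdaTwo A * momentNorm P 2 v := by
  have h0 := ha 0 (by norm_num)
  have h1 := ha 1 (by norm_num)
  have h2 := ha 2 (by norm_num)
  have h3 := ha 3 (by norm_num)
  have A0 := hA 0 (by norm_num)
  have A1 := hA 1 (by norm_num)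
  have A2 := hA 2 (by norm_num)
  have A3 := hA 3 (by norm_num)
  calc _ = ∫⁻ ω, (a 1 ω * a 1 ω * a 1 ω * v ω + (a 0 ω * a 1 ω * a 2 ω * v ω +
        (a 0 ω * a 0 ω * a 3 ω * v ω + (a 1 ω * a 2 ω * v ω + (a 0 ω * a 3 ω * v ω +
          a 3 ω * v ω))))) ∂P := by
        refine lintegral_congr fun ω => ?_
        ring
    _ = ∫⁻ ω, a 1 ω * a 1 ω * a 1 ω * v ω ∂P + (∫⁻ ω, a 0 ω * a 1 ω * a 2 ω * v ω ∂P +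
        (∫⁻ ω, a 0 ω * a 0 ω * a 3 ω * v ω ∂P + (∫⁻ ω, a 1 ω * a 2 ω * v ω ∂P +
          (∫⁻ ω, a 0 ω * a 3 ω * v ω ∂P + ∫⁻ ω, a 3 ω * v ω ∂P)))) := by
        rw [lintegral_add_left (by fun_prop), lintegral_add_left (by fun_prop),
          lintegral_add_left (by fun_prop), lintegral_add_left (by fun_prop),
          lintegral_add_left (by fun_prop)]
    _ ≤ A 1 6 * A 1 6 * A 1 6 * momentNorm P 2 v + (A 0 6 * A 1 6 * A 2 6 * momentNorm P 2 v +
        (A 0 6 * A 0 6 * A 3 6 * momentNorm P 2 v + (A 1 4 * A 2 4 * momentNorm P 2 v +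
          (A 0 4 * A 3 4 * momentNorm P 2 v + A 3 2 * momentNorm P 2 v)))) := by
        gcongr
        · exact (lintegral_mul₃_mul_le_momentNorm h1 h1 h1 hv).trans
            (by gcongr <;> first | exact A1 _)
        · exact (lintegral_mul₃_mul_le_momentNorm h0 h1 h2 hv).trans
            (by gcongr <;> first | exact A0 _ | exact A1 _ | exact A2 _)
        · exact (lintegral_mul₃_mul_le_momentNorm h0 h0 h3 hv).trans
            (by gcongr <;> first | exact A0 _ | exact A3 _)
        · exact (lintegral_mul_mul_le_momentNorm h1 h2 hv).trans
            (by gcongr <;> first | exact A1 _ | exact A2 _)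
        · exact (lintegral_mul_mul_le_momentNorm h0 h3 hv).trans
            (by gcongr <;> first | exact A0 _ | exact A3 _)
        · exact (lintegral_mul_le_momentNorm h3 hv).trans (by gcongr; exact A3 _)
    _ = _ := by rw [lambdaTwo]; ring

lemma lintegral_le_lambdaOne {A : ℕ → ℕ → ℝ≥0∞} {a : ℕ → Ω → ℝ≥0∞}
    (ha : ∀ r ≤ 2, Measurable (a r)) (hA : ∀ r ≤ 2, ∀ m, momentNorm P m (a r) ≤ A r m) :
    ∫⁻ ω, ((1 + a 0 ω) * a 1 ω ^ 2 + (1 + a 0 ω + a 0 ω ^ 2) * a 2 ω) ∂P ≤ lambdaOne A := by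
  have h0 := ha 0 (by norm_num)
  have h1 := ha 1 (by norm_num)
  have h2 := ha 2 (by norm_num)
  have A0 := hA 0 (by norm_num)
  have A1 := hA 1 (by norm_num)
  have A2 := hA 2 (by norm_num)
  calc _ = ∫⁻ ω, (a 0 ω * a 1 ω * a 1 ω + (a 0 ω * a 0 ω * a 2 ω +
        (a 1 ω * a 1 ω + (a 0 ω * a 2 ω + a 2 ω)))) ∂P := by
        refine lintegral_congr fun ω => ?_
        ring
    _ = ∫⁻ ω, a 0 ω * a 1 ω * a 1 ω ∂P + (∫⁻ ω, a 0 ω * a 0 ω * a 2 ω ∂P +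
        (∫⁻ ω, a 1 ω * a 1 ω ∂P + (∫⁻ ω, a 0 ω * a 2 ω ∂P + ∫⁻ ω, a 2 ω ∂P))) := by
        rw [lintegral_add_left (by fun_prop), lintegral_add_left (by fun_prop),
          lintegral_add_left (by fun_prop), lintegral_add_left (by fun_prop)]
    _ ≤ A 0 3 * A 1 3 * A 1 3 + (A 0 3 * A 0 3 * A 2 3 + (A 1 2 * A 1 2 +
        (A 0 2 * A 2 2 + A 2 1))) := by
        gcongr
        · exact (lintegral_mul₃_le_momentNorm h0 h1 h1).trans
            (by gcongr <;> first | exact A0 _ | exact A1 _)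
        · exact (lintegral_mul₃_le_momentNorm h0 h0 h2).trans
            (by gcongr <;> first | exact A0 _ | exact A2 _)
        · exact (lintegral_mul_le_momentNorm h1 h1).trans (by gcongr <;> exact A1 _)
        · exact (lintegral_mul_le_momentNorm h0 h2).trans
            (by gcongr <;> first | exact A0 _ | exact A2 _)
        · exact (lintegral_eq_momentNorm_one _).trans_le (A2 _)
    _ = _ := by rw [lambdaOne]; ring

end Moments

/-! ### The second-order expansion in coordinates. -/

section Expansion

variable {Ω A F ι : Type*} [NormedAddCommGroup A] [NormedSpace ℝ A]
  [NormedAddCommGroup F] [NormedSpace ℝ F] [DecidableEq ι]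

/-- Coordinates of the first derivative of `w ↦ h (f (x + L w))` at `0`. -/
def gradCoeff (h : F → ℝ) (f : A → F) (L : EuclideanSpace ℝ ι →L[ℝ] A) (a : ι) (x : A) : ℝ :=
  fderiv ℝ h (f x) (fderiv ℝ f x (L (EuclideanSpace.single a 1)))

/-- Coordinates of the second derivative of `w ↦ h (f (x + L w))` at `0`. -/
def hessCoeff (h : F → ℝ) (f : A → F) (L : EuclideanSpace ℝ ι →L[ℝ] A) (a b : ι) (x : A) : ℝ :=
  fderiv ℝ (fderiv ℝ h) (f x) (fderiv ℝ f x (L (EuclideanSpace.single a 1)))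
      (fderiv ℝ f x (L (EuclideanSpace.single b 1))) +
    fderiv ℝ h (f x) (fderiv ℝ (fderiv ℝ f) x (L (EuclideanSpace.single a 1))
      (L (EuclideanSpace.single b 1)))

lemma continuous_gradCoeff {h : F → ℝ} {f : A → F} (hh : ThriceDifferentiable h)
    (hf : ThriceDifferentiable f) (L : EuclideanSpace ℝ ι →L[ℝ] A) (a : ι) :
    Continuous (gradCoeff h f L a) :=
  (hh.2.1.continuous.comp hf.1.continuous).clm_apply
    (hf.2.1.continuous.clm_apply continuous_const)

lemma continuous_hessCoeff {h : F → ℝ} {f : A → F} (hh : ThriceDifferentiable h)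
    (hf : ThriceDifferentiable f) (L : EuclideanSpace ℝ ι →L[ℝ] A) (a b : ι) :
    Continuous (hessCoeff h f L a b) :=
  (((hh.2.2.continuous.comp hf.1.continuous).clm_apply
    (hf.2.1.continuous.clm_apply continuous_const)).clm_apply
    (hf.2.1.continuous.clm_apply continuous_const)).add
  ((hh.2.1.continuous.comp hf.1.continuous).clm_apply
    ((hf.2.2.continuous.clm_apply continuous_const).clm_apply continuous_const))

variable [Fintype ι]

/-- The remainder of the second-order Taylor expansion of `h ∘ f` at `x` in direction `L v`. -/
def taylorRemainder (h : F → ℝ) (f : A → F) (L : EuclideanSpace ℝ ι →L[ℝ] A) (x : A)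
    (v : EuclideanSpace ℝ ι) : ℝ :=
  h (f (x + L v)) - h (f x) - ∑ a, v a * gradCoeff h f L a x -
    (∑ a, ∑ b, v a * v b * hessCoeff h f L a b x) / 2

/-- `sup_{w ∈ [0, V]} ‖D^r f(R + L w)‖`, the derivative being taken in `w`. -/
def segmentSup (f : A → F) (L : EuclideanSpace ℝ ι →L[ℝ] A) (R : Ω → A)
    (V : Ω → EuclideanSpace ℝ ι) (r : ℕ) (ω : Ω) : ℝ≥0∞ :=
  ⨆ w ∈ segment ℝ 0 (V ω),
    ENNReal.ofReal (flatNorm (iteratedFDeriv ℝ r (fun w => f (R ω + L w)) w))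

lemma le_segmentSup (f : A → F) (L : EuclideanSpace ℝ ι →L[ℝ] A) (R : Ω → A)
    (V : Ω → EuclideanSpace ℝ ι) (r : ℕ) (ω : Ω) {t : ℝ} (ht : t ∈ Set.Icc (0 : ℝ) 1) :
    ENNReal.ofReal (flatNorm (iteratedFDeriv ℝ r (fun w => f (R ω + L w)) (t • V ω))) ≤
      segmentSup f L R V r ω := by
  have hmem : t • V ω ∈ segment ℝ 0 (V ω) :=
    ⟨1 - t, t, by linarith [ht.2], ht.1, by ring, by simp⟩
  exact le_iSup₂ (f := fun w (_ : w ∈ segment ℝ 0 (V ω)) =>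
    ENNReal.ofReal (flatNorm (iteratedFDeriv ℝ r (fun w => f (R ω + L w)) w))) _ hmem

lemma clm_apply_eq_sum (S : EuclideanSpace ℝ ι →L[ℝ] F) (v : EuclideanSpace ℝ ι) :
    S v = ∑ a, v a • S (EuclideanSpace.single a 1) := by
  conv_lhs => rw [euclideanSpace_eq_sum_single v]
  simp only [map_sum, map_smul]

lemma clm_apply_apply_eq_sum (N : EuclideanSpace ℝ ι →L[ℝ] EuclideanSpace ℝ ι →L[ℝ] F)
    (v : EuclideanSpace ℝ ι) : N v v =
      ∑ a, ∑ b, (v a * v b) • N (EuclideanSpace.single a 1) (EuclideanSpace.single b 1) := by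
  rw [clm_apply_eq_sum N v, sum_apply]
  refine Finset.sum_congr rfl fun a _ => ?_
  rw [smul_apply, clm_apply_eq_sum (N _) v, Finset.smul_sum]
  simp only [smul_smul]

lemma fderiv_comp_affine_zero {f : A → F} (hf : Differentiable ℝ f)
    (L : EuclideanSpace ℝ ι →L[ℝ] A) (x : A) (y : EuclideanSpace ℝ ι) :
    fderiv ℝ (fun w => f (x + L w)) 0 y = fderiv ℝ f x (L y) := by
  simp [fderiv_comp_affine hf]

lemma fderiv₂_comp_affine_zero {f : A → F} (hf : ThriceDifferentiable f)
    (L : EuclideanSpace ℝ ι →L[ℝ] A) (x : A) (y z : EuclideanSpace ℝ ι) :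
    fderiv ℝ (fderiv ℝ (fun w => f (x + L w))) 0 y z =
      fderiv ℝ (fderiv ℝ f) x (L y) (L z) := by
  simp [fderiv₂_comp_affine hf]

/-- Links two forms of the remainder: coordinates are needed so that independence can factor scalar
products, the coordinate-free form for Taylor's formula. -/
lemma taylorRemainder_eq {h : F → ℝ} {f : A → F} (hf : ThriceDifferentiable f)
    (L : EuclideanSpace ℝ ι →L[ℝ] A) (x : A) (v : EuclideanSpace ℝ ι) {g : EuclideanSpace ℝ ι → F}
    (hg : g = fun w => f (x + L w)) :
    taylorRemainder h f L x v = h (g v) - h (g 0) - fderiv ℝ h (g 0) (fderiv ℝ g 0 v) -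
      (fderiv ℝ (fderiv ℝ h) (g 0) (fderiv ℝ g 0 v) (fderiv ℝ g 0 v) +
        fderiv ℝ h (g 0) (fderiv ℝ (fderiv ℝ g) 0 v v)) / 2 := by
  have hD1 : ∀ y, fderiv ℝ g 0 y = fderiv ℝ f x (L y) := fun y => by
    rw [hg, fderiv_comp_affine_zero hf.1]
  have hD2 : ∀ y z, fderiv ℝ (fderiv ℝ g) 0 y z = fderiv ℝ (fderiv ℝ f) x (L y) (L z) :=
    fun y z => by rw [hg, fderiv₂_comp_affine_zero hf]
  have hg0 : g 0 = f x := by simp [hg]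
  have hgv : g v = f (x + L v) := by simp [hg]
  have e1 := clm_apply_eq_sum ((fderiv ℝ h (g 0)).comp (fderiv ℝ g 0)) v
  have e2 := clm_apply_apply_eq_sum ((ContinuousLinearMap.precomp ℝ (fderiv ℝ g 0)).comp
    ((fderiv ℝ (fderiv ℝ h) (g 0)).comp (fderiv ℝ g 0))) v
  have e3 := congrArg (fderiv ℝ h (g 0)) (clm_apply_apply_eq_sum (fderiv ℝ (fderiv ℝ g) 0) v)
  simp only [ContinuousLinearMap.comp_apply, ContinuousLinearMap.precomp_apply, map_sum,
    map_smul] at e1 e2 e3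
  rw [e1, e2, e3, ← Finset.sum_add_distrib, taylorRemainder, hgv]
  simp only [← Finset.sum_add_distrib, smul_eq_mul, ← mul_add, hD1, hD2, hg0]
  rfl

lemma enorm_le_of_abs_le {x : ℝ} {a b c d : F} (h : |x| ≤ ‖b‖ ^ 3 + (1 + ‖a‖) * ‖b‖ * ‖c‖ +
    (1 + ‖a‖ + ‖a‖ ^ 2) * ‖d‖) : ‖x‖ₑ ≤ ‖b‖ₑ ^ 3 + (1 + ‖a‖ₑ) * ‖b‖ₑ * ‖c‖ₑ +
    (1 + ‖a‖ₑ + ‖a‖ₑ ^ 2) * ‖d‖ₑ := by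
  simp only [← Real.norm_eq_abs, ← coe_nnnorm] at h
  simp only [enorm_eq_nnnorm]
  exact_mod_cast h

end Expansion

/-! ### Integrating the third-order remainder. -/

section Swap

variable {Ω A F ι : Type*} [MeasurableSpace Ω] {P : Measure Ω}
  [NormedAddCommGroup A] [NormedSpace ℝ A] [MeasurableSpace A] [BorelSpace A]
  [SecondCountableTopology A]
  [NormedAddCommGroup F] [NormedSpace ℝ F] [MeasurableSpace F] [BorelSpace F]
  [SecondCountableTopology F]
  [Fintype ι] [DecidableEq ι]

/-- Measurable minorants of the suprema `segmentSup` that still control the derivatives of `f`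
along the open segment. -/
lemma exists_measurable_le_segmentSup {f : A → F} (hf : ThriceDifferentiable f)
    (L : EuclideanSpace ℝ ι →L[ℝ] A) {R : Ω → A} (hR : Measurable R)
    {V : Ω → EuclideanSpace ℝ ι} (hV : Measurable V) :
    ∃ G : ℕ → Ω → ℝ≥0∞, (∀ r ≤ 3, Measurable (G r)) ∧
      (∀ r ≤ 3, ∀ ω, G r ω ≤ segmentSup f L R V r ω) ∧
      ∀ ω, ∀ g, g = (fun w => f (R ω + L w)) → ∀ t ∈ Set.Ioo (0 : ℝ) 1,
        ‖g (t • V ω)‖ₑ ≤ G 0 ω ∧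
        ‖fderiv ℝ g (t • V ω) (V ω)‖ₑ ≤ G 1 ω * ‖V ω‖ₑ ∧
        ‖fderiv ℝ (fderiv ℝ g) (t • V ω) (V ω) (V ω)‖ₑ ≤ G 2 ω * ‖V ω‖ₑ ^ 2 ∧
        ‖fderiv ℝ (fderiv ℝ (fderiv ℝ g)) (t • V ω) (V ω) (V ω) (V ω)‖ₑ ≤
          G 3 ω * ‖V ω‖ₑ ^ 3 := by
  -- The direction of `V`, equal to `0` where `V` vanishes because `0⁻¹ = 0`. Powers of `‖V‖` are
  -- restored at the end by homogeneity.
  let e : Ω → EuclideanSpace ℝ ι := fun ω => ‖V ω‖⁻¹ • V ω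
  have hem : Measurable e := hV.norm.inv.smul hV
  have hVe : ∀ ω, V ω = ‖V ω‖ • e ω := fun ω => by
    rcases eq_or_ne (V ω) 0 with h | h
    · simp [e, h]
    · rw [smul_smul, mul_inv_cancel₀ (norm_ne_zero_iff.2 h), one_smul]
  have he1 : ∀ ω, ‖e ω‖ ≤ 1 := fun ω => by
    rw [norm_smul, norm_inv, norm_norm]
    exact inv_mul_le_one
  have hg : ∀ ω, ThriceDifferentiable fun w => f (R ω + L w) := fun ω => hf.comp_affine _ _
  have hRt : ∀ t : ℝ, Measurable fun ω => R ω + L (t • V ω) := fun t =>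
    hR.add (L.continuous.measurable.comp (hV.const_smul t))
  have hLe : Measurable fun ω => L (e ω) := L.continuous.measurable.comp hem
  have hline : ∀ v : EuclideanSpace ℝ ι, Continuous fun t : ℝ => t • v :=
    fun v => continuous_id.smul continuous_const
  obtain ⟨G0, m0, l0, u0⟩ := exists_measurable_sup_path
    (fun ω t => f (R ω + L (t • V ω)))
    (fun t => hf.1.continuous.measurable.comp (hRt t))
    (fun ω => (hg ω).1.continuous.comp (hline _))
  obtain ⟨G1, m1, l1, u1⟩ := exists_measurable_sup_path
    (fun ω t => fderiv ℝ (fun w => f (R ω + L w)) (t • V ω) (e ω))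
    (fun t => by
      simp only [fderiv_comp_affine hf.1]
      exact hf.continuous_fderiv_apply.measurable.comp ((hRt t).prodMk hLe))
    (fun ω => ((hg ω).2.1.continuous.comp (hline _)).clm_apply continuous_const)
  have hm2 : ∀ t : ℝ, Measurable fun ω =>
      fderiv ℝ (fderiv ℝ (fun w => f (R ω + L w))) (t • V ω) (e ω) (e ω) := fun t => by
    simp only [fderiv₂_comp_affine hf]
    exact hf.continuous_fderiv₂_apply.measurable.comp ((hRt t).prodMk (hLe.prodMk hLe))
  obtain ⟨G2, m2, l2, u2⟩ := exists_measurable_sup_path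
    (fun ω t => fderiv ℝ (fderiv ℝ (fun w => f (R ω + L w))) (t • V ω) (e ω) (e ω)) hm2
    (fun ω => (((hg ω).2.2.continuous.comp (hline _)).clm_apply continuous_const).clm_apply
      continuous_const)
  -- Differentiating along `t • V` produces one argument `V`, which the prefactor `‖V‖⁻¹` turns into
  -- `e`; thus the third derivative in direction `e` is the derivative of a measurable path.
  have hd3 : ∀ ω t, HasDerivAt (fun t : ℝ => ‖V ω‖⁻¹ •
      fderiv ℝ (fderiv ℝ (fun w => f (R ω + L w))) (t • V ω) (e ω) (e ω))
      (fderiv ℝ (fderiv ℝ (fderiv ℝ (fun w => f (R ω + L w)))) (t • V ω) (e ω) (e ω) (e ω))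
      t := fun ω t => by
    have := (((hasDerivAt_line (hg ω).2.2 (V ω) t).clm_apply
      (hasDerivAt_const t (e ω))).clm_apply (hasDerivAt_const t (e ω))).const_smul ‖V ω‖⁻¹
    refine this.congr_deriv ?_
    simp [e]
  obtain ⟨G3, m3, l3, u3⟩ := exists_measurable_sup_deriv _ _
    (fun t => hV.norm.inv.smul (hm2 t)) hd3
  let G : ℕ → Ω → ℝ≥0∞ := fun r => match r with
    | 0 => G0 | 1 => G1 | 2 => G2 | _ => G3
  refine ⟨G, ?_, ?_, ?_⟩
  · intro r hr
    interval_cases r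
    exacts [m0, m1, m2, m3]
  · intro r hr ω
    have key : ∀ t ∈ Set.Icc (0 : ℝ) 1, ∀ x : F,
        ‖x‖ ≤ flatNorm (iteratedFDeriv ℝ r (fun w => f (R ω + L w)) (t • V ω)) →
        ‖x‖ₑ ≤ segmentSup f L R V r ω := fun t ht x hx => by
      rw [← ofReal_norm]
      exact (ENNReal.ofReal_le_ofReal hx).trans (le_segmentSup f L R V r ω ht)
    have mul1 : ∀ (c : ℝ), 0 ≤ c → c * ‖e ω‖ ≤ c := fun c hc =>
      mul_le_of_le_one_right hc (he1 ω)
    interval_cases r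
    · refine u0 ω _ fun t ht => key t ht _ ?_
      rw [flatNorm_iteratedFDeriv_zero]
    · refine u1 ω _ fun t ht => key t ht _ ?_
      exact (norm_fderiv_apply_le_flatNorm _ _ _).trans (mul1 _ (flatNorm_nonneg _))
    · refine u2 ω _ fun t ht => key t ht _ ?_
      exact (norm_fderiv₂_apply_le_flatNorm _ _ _ _).trans
        ((mul1 _ (mul_nonneg (flatNorm_nonneg _) (norm_nonneg _))).trans
          (mul1 _ (flatNorm_nonneg _)))
    · refine u3 ω _ fun t ht => key t ht _ ?_
      exact (norm_fderiv₃_apply_le_flatNorm _ _ _ _ _).trans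
        ((mul1 _ (mul_nonneg (mul_nonneg (flatNorm_nonneg _) (norm_nonneg _))
          (norm_nonneg _))).trans ((mul1 _ (mul_nonneg (flatNorm_nonneg _) (norm_nonneg _))).trans
          (mul1 _ (flatNorm_nonneg _))))
  · rintro ω _ rfl t ht
    have ht' := Set.mem_Icc_of_Ioo ht
    -- Naming direction and length shields the occurrences of `V ω` inside `e ω` and `‖V ω‖` from
    -- the rewriting of `V ω`.
    obtain ⟨x, c, hx, hc⟩ : ∃ x c, x = e ω ∧ c = ‖V ω‖ := ⟨_, _, rfl, rfl⟩
    have hVx : V ω = c • x := by rw [hx, hc]; exact hVe ω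
    have s1 : ∀ M : EuclideanSpace ℝ ι →L[ℝ] F, M (V ω) = ‖V ω‖ • M (e ω) := fun M => by
      rw [← hx, ← hc, hVx, map_smul]
    have s2 : ∀ M : EuclideanSpace ℝ ι →L[ℝ] EuclideanSpace ℝ ι →L[ℝ] F,
        M (V ω) (V ω) = ‖V ω‖ ^ 2 • M (e ω) (e ω) := fun M => by
      
      rw [← hx, ← hc, hVx]
      simp only [map_smul, smul_apply, smul_smul, sq]
    have s3 : ∀ M : EuclideanSpace ℝ ι →L[ℝ] EuclideanSpace ℝ ι →L[ℝ]
        EuclideanSpace ℝ ι →L[ℝ] F,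
        M (V ω) (V ω) (V ω) = ‖V ω‖ ^ 3 • M (e ω) (e ω) (e ω) := fun M => by
      rw [← hx, ← hc, hVx]
      simp only [map_smul, smul_apply, smul_smul]
      congr 1
      ring
    refine ⟨l0 ω t ht', ?_, ?_, ?_⟩
    · rw [s1, enorm_smul, enorm_norm, mul_comm]
      gcongr
      exact l1 ω t ht'
    · rw [s2, enorm_smul, enorm_pow, enorm_norm, mul_comm]
      gcongr
      exact l2 ω t ht'
    · rw [s3, enorm_smul, enorm_pow, enorm_norm, mul_comm]
      gcongr
      exact l3 ω t ht

lemma lintegral_taylorRemainder_le {h : F → ℝ} (hh : TestBounds h) {f : A → F}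
    (hf : ThriceDifferentiable f)
    (L : EuclideanSpace ℝ ι →L[ℝ] A) {R : Ω → A} (hR : Measurable R)
    {V : Ω → EuclideanSpace ℝ ι} (hV : Measurable V) {α : ℕ → ℕ → ℝ≥0∞}
    (hα : ∀ r ≤ 3, ∀ m, momentNorm P m (segmentSup f L R V r) ≤ α r m) :
    ∫⁻ ω, ‖taylorRemainder h f L (R ω) (V ω)‖ₑ ∂P ≤
      lambdaTwo α * momentNorm P 2 fun ω => ‖V ω‖ₑ ^ 3 := by
  obtain ⟨G, hGm, hGs, hG⟩ := exists_measurable_le_segmentSup hf L hR hV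
  refine le_trans (lintegral_mono fun ω => ?_) (lintegral_le_lambdaTwo (a := G)
    hGm (hV.enorm.pow_const 3) fun r hr m => (momentNorm_mono (hGs r hr)).trans (hα r hr m))
  set g : EuclideanSpace ℝ ι → F := fun w => f (R ω + L w) with hgdef
  have hg : ThriceDifferentiable g := hf.comp_affine _ _
  -- The point `ξ` depends on `ω` with no control on measurability; this is harmless, as the bounds
  -- `G r` do not involve it.
  obtain ⟨ξ, hξ, hb⟩ := hh.exists_taylor_bound (hasDerivAt_line hg.1 (V ω))
    (hasDerivAt_line₁ hg (V ω)) (hasDerivAt_line₂ hg (V ω))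
  obtain ⟨b0, b1, b2, b3⟩ := hG ω g hgdef ξ hξ
  simp only [zero_smul, one_smul] at hb
  rw [← taylorRemainder_eq hf L (R ω) (V ω) hgdef] at hb
  have hb2 := enorm_le_of_abs_le hb
  calc _ ≤ _ := hb2
    _ ≤ (G 1 ω * ‖V ω‖ₑ) ^ 3 + (1 + G 0 ω) * (G 1 ω * ‖V ω‖ₑ) * (G 2 ω * ‖V ω‖ₑ ^ 2) +
        (1 + G 0 ω + G 0 ω ^ 2) * (G 3 ω * ‖V ω‖ₑ ^ 3) := by gcongr
    _ = _ := by ring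

end Swap

/-! ### Pointwise bounds on gradient and Hessian coefficients. -/

section Pointwise

variable {Ω A F ι : Type*}
  [NormedAddCommGroup A] [NormedSpace ℝ A]
  [NormedAddCommGroup F] [NormedSpace ℝ F]
  [Fintype ι] [DecidableEq ι]

/-- `‖D^r f(R + L w)‖` at `w = 0`, as an extended nonnegative real. -/
def baseNorm (f : A → F) (L : EuclideanSpace ℝ ι →L[ℝ] A) (R : Ω → A) (r : ℕ) (ω : Ω) : ℝ≥0∞ :=
  ENNReal.ofReal (flatNorm (iteratedFDeriv ℝ r (fun w => f (R ω + L w)) 0))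

lemma baseNorm_le_segmentSup (f : A → F) (L : EuclideanSpace ℝ ι →L[ℝ] A) (R : Ω → A)
    (V : Ω → EuclideanSpace ℝ ι) (r : ℕ) (ω : Ω) :
    baseNorm f L R r ω ≤ segmentSup f L R V r ω := by
  have := le_segmentSup f L R V r ω (t := 0) (by simp)
  rwa [zero_smul] at this

lemma norm_gradCoeff_le {h : F → ℝ} (hh : TestBounds h) {f : A → F}
    (hf : ThriceDifferentiable f) (L : EuclideanSpace ℝ ι →L[ℝ] A) (x : A) (a : ι) :
    ‖gradCoeff h f L a x‖ ≤ (1 + ‖f x‖ + ‖f x‖ ^ 2) *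
      flatNorm (iteratedFDeriv ℝ 1 (fun w => f (x + L w)) 0) := by
  have h1 := norm_fderiv_apply_le_flatNorm (fun w => f (x + L w)) 0
    (EuclideanSpace.single a (1 : ℝ))
  rw [fderiv_comp_affine_zero hf.1] at h1
  simp only [PiLp.norm_single, norm_one, mul_one] at h1
  refine (ContinuousLinearMap.le_opNorm _ _).trans ?_
  have := hh.norm_le₁ (f x)
  gcongr

lemma norm_hessCoeff_le {h : F → ℝ} (hh : TestBounds h) (f : A → F)
    (L : EuclideanSpace ℝ ι →L[ℝ] A) (x : A) (a b : ι) :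
    ‖hessCoeff h f L a b x‖ ≤ (1 + ‖f x‖) * (‖fderiv ℝ f x (L (EuclideanSpace.single a 1))‖ *
        ‖fderiv ℝ f x (L (EuclideanSpace.single b 1))‖) + (1 + ‖f x‖ + ‖f x‖ ^ 2) *
      ‖fderiv ℝ (fderiv ℝ f) x (L (EuclideanSpace.single a 1))
        (L (EuclideanSpace.single b 1))‖ := by
  have b1 := hh.norm_le₁ (f x)
  have b2 := hh.norm_le₂ (f x)
  refine (norm_add_le _ _).trans ?_
  rw [← mul_assoc]
  gcongr
  · refine (ContinuousLinearMap.le_opNorm₂ _ _ _).trans ?_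
    gcongr
  · refine (ContinuousLinearMap.le_opNorm _ _).trans ?_
    gcongr

/-- The pairing of the Hessian coefficients with a matrix is controlled by Frobenius norms. -/
lemma sum_norm_mul_hessCoeff_le {h : F → ℝ} (hh : TestBounds h) {f : A → F}
    (hf : ThriceDifferentiable f) (L : EuclideanSpace ℝ ι →L[ℝ] A) (x : A) (M : ι → ι → ℝ) :
    ‖∑ a, ∑ b, M a b * hessCoeff h f L a b x‖ ≤ √(∑ a, ∑ b, M a b ^ 2) *
      ((1 + ‖f x‖) * flatNorm (iteratedFDeriv ℝ 1 (fun w => f (x + L w)) 0) ^ 2 +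
        (1 + ‖f x‖ + ‖f x‖ ^ 2) *
          flatNorm (iteratedFDeriv ℝ 2 (fun w => f (x + L w)) 0)) := by
  set u : ι → ℝ := fun a => ‖fderiv ℝ f x (L (EuclideanSpace.single a 1))‖
  set w : ι → ι → ℝ := fun a b => ‖fderiv ℝ (fderiv ℝ f) x (L (EuclideanSpace.single a 1))
        (L (EuclideanSpace.single b 1))‖
  -- Cauchy-Schwarz over pairs of indices keeps the Frobenius norm of `M`; an entrywise bound would
  -- cost further powers of the dimension.
  have cs : ∀ U : ι → ι → ℝ, ∑ a, ∑ b, ‖M a b‖ * U a b ≤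
      √(∑ a, ∑ b, M a b ^ 2) * √(∑ a, ∑ b, U a b ^ 2) := fun U => by
    have := Real.sum_mul_le_sqrt_mul_sqrt (Finset.univ : Finset (ι × ι))
      (fun p => ‖M p.1 p.2‖) (fun p => U p.1 p.2)
    simpa [Fintype.sum_prod_type] using this
  -- The rank-one matrix `u a * u b` has Frobenius norm `∑ a, u a ^ 2`.
  have e1 : flatNorm (iteratedFDeriv ℝ 1 (fun w => f (x + L w)) 0) ^ 2 =
      √(∑ a, ∑ b, (u a * u b) ^ 2) := by
    have : ∑ a, ∑ b, (u a * u b) ^ 2 = (∑ a, u a ^ 2) ^ 2 := by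
      simp_rw [mul_pow, sq (∑ a, u a ^ 2), Finset.sum_mul_sum]
    rw [this, Real.sqrt_sq (by positivity), flatNorm_iteratedFDeriv_one_sq]
    simp only [fderiv_comp_affine_zero hf.1]
    rfl
  have e2 : flatNorm (iteratedFDeriv ℝ 2 (fun w => f (x + L w)) 0) =
      √(∑ a, ∑ b, w a b ^ 2) := by
    rw [← Real.sqrt_sq (flatNorm_nonneg _), flatNorm_iteratedFDeriv_two_sq]
    simp only [fderiv₂_comp_affine_zero hf]
    rfl
  rw [e1, e2]
  calc _ ≤ ∑ a, ∑ b, ‖M a b‖ * ((1 + ‖f x‖) * (u a * u b) +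
        (1 + ‖f x‖ + ‖f x‖ ^ 2) * w a b) := by
        refine norm_sum_le_of_le _ fun a _ => norm_sum_le_of_le _ fun b _ => ?_
        rw [norm_mul]
        gcongr
        exact norm_hessCoeff_le hh f L x a b
    _ = (1 + ‖f x‖) * ∑ a, ∑ b, ‖M a b‖ * (u a * u b) +
        (1 + ‖f x‖ + ‖f x‖ ^ 2) * ∑ a, ∑ b, ‖M a b‖ * w a b := by
        simp_rw [Finset.mul_sum, ← Finset.sum_add_distrib]
        refine Finset.sum_congr rfl fun a _ => Finset.sum_congr rfl fun b _ => by ring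
    _ ≤ (1 + ‖f x‖) * (√(∑ a, ∑ b, M a b ^ 2) * √(∑ a, ∑ b, (u a * u b) ^ 2)) +
        (1 + ‖f x‖ + ‖f x‖ ^ 2) * (√(∑ a, ∑ b, M a b ^ 2) * √(∑ a, ∑ b, w a b ^ 2)) := by
        gcongr
        · exact cs fun a b => u a * u b
        · exact cs w
    _ = _ := by ring

end Pointwise

/-! ### Expected expansions and the cost of one replacement. -/

section Expectation

variable {Ω A F ι : Type*} [MeasurableSpace Ω] {P : Measure Ω}
  [NormedAddCommGroup A] [NormedSpace ℝ A] [MeasurableSpace A] [BorelSpace A]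
  [NormedAddCommGroup F] [NormedSpace ℝ F] [MeasurableSpace F] [BorelSpace F]
  [SecondCountableTopology F]

/-- `h` grows at most cubically, so a finite sixth moment of `U` is more than enough. -/
lemma TestBounds.integrable_comp [IsFiniteMeasure P] {h : F → ℝ} (hh : TestBounds h)
    {U : Ω → F} (hU : Measurable U) (h6 : momentNorm P 6 (fun ω => ‖U ω‖ₑ) ≠ ∞) :
    Integrable (fun ω => h (U ω)) P := by
  have hp : ∀ m ≤ 6, m ≠ 0 → ∫⁻ ω, ‖U ω‖ₑ ^ m ∂P ≠ ∞ := fun m hm h0 ht => by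
    apply momentNorm_ne_top_of_le_six hm h6
    rw [momentNorm, ht, ENNReal.top_rpow_of_pos (by positivity)]
  refine ⟨(hh.thrice.1.continuous.measurable.comp hU).aestronglyMeasurable, ?_⟩
  refine lt_of_le_of_lt (lintegral_mono (g := fun ω =>
    ‖h 0‖ₑ + (‖U ω‖ₑ ^ 1 + (‖U ω‖ₑ ^ 2 + ‖U ω‖ₑ ^ 3))) fun ω => ?_) ?_
  · have := hh.norm_le (U ω)
    rw [add_assoc] at this
    simp only [← coe_nnnorm] at this
    simp only [enorm_eq_nnnorm, pow_one]
    exact_mod_cast this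
  · rw [lintegral_add_left measurable_const, lintegral_add_left (hU.enorm.pow_const 1),
      lintegral_add_left (hU.enorm.pow_const 2)]
    have h1 := hp 1 (by norm_num) (by norm_num)
    have h2 := hp 2 (by norm_num) (by norm_num)
    have h3 := hp 3 (by norm_num) (by norm_num)
    simp only [lintegral_const]
    exact (ENNReal.add_ne_top.2 ⟨by finiteness, ENNReal.add_ne_top.2
      ⟨h1, ENNReal.add_ne_top.2 ⟨h2, h3⟩⟩⟩).lt_top

variable [Fintype ι] [DecidableEq ι]

lemma measurable_baseNorm {f : A → F} (hf : ThriceDifferentiable f)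
    (L : EuclideanSpace ℝ ι →L[ℝ] A) {R : Ω → A} (hR : Measurable R) :
    ∀ r ≤ 2, Measurable (baseNorm f L R r) := by
  intro r hr
  refine ENNReal.measurable_ofReal.comp ?_
  interval_cases r
  · simp only [flatNorm_iteratedFDeriv_zero, map_zero, add_zero]
    exact (hf.1.continuous.norm.measurable).comp hR
  · have : ∀ ω, flatNorm (iteratedFDeriv ℝ 1 (fun w => f (R ω + L w)) 0) =
        √(∑ a, ‖fderiv ℝ f (R ω) (L (EuclideanSpace.single a 1))‖ ^ 2) := fun ω => by
      rw [← Real.sqrt_sq (flatNorm_nonneg _), flatNorm_iteratedFDeriv_one_sq]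
      simp only [fderiv_comp_affine_zero hf.1]
    simp only [this]
    refine Continuous.measurable (f := fun x : A =>
      √(∑ a, ‖fderiv ℝ f x (L (EuclideanSpace.single a 1))‖ ^ 2)) ?_ |>.comp hR
    exact (continuous_finsetSum _ fun a _ =>
      (hf.2.1.continuous.clm_apply continuous_const).norm.pow 2).sqrt
  · have : ∀ ω, flatNorm (iteratedFDeriv ℝ 2 (fun w => f (R ω + L w)) 0) =
        √(∑ a, ∑ b, ‖fderiv ℝ (fderiv ℝ f) (R ω) (L (EuclideanSpace.single a 1))
          (L (EuclideanSpace.single b 1))‖ ^ 2) := fun ω => by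
      rw [← Real.sqrt_sq (flatNorm_nonneg _), flatNorm_iteratedFDeriv_two_sq]
      simp only [fderiv₂_comp_affine_zero hf]
    simp only [this]
    refine Continuous.measurable (f := fun x : A =>
      √(∑ a, ∑ b, ‖fderiv ℝ (fderiv ℝ f) x (L (EuclideanSpace.single a 1))
          (L (EuclideanSpace.single b 1))‖ ^ 2)) ?_ |>.comp hR
    exact (continuous_finsetSum _ fun a _ => continuous_finsetSum _ fun b _ =>
      ((hf.2.2.continuous.clm_apply continuous_const).clm_apply continuous_const).norm.pow 2).sqrt

lemma lintegral_sum_mul_hessCoeff_le {h : F → ℝ} (hh : TestBounds h) {f : A → F}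
    (hf : ThriceDifferentiable f) (L : EuclideanSpace ℝ ι →L[ℝ] A) {R : Ω → A}
    (hR : Measurable R) (M : ι → ι → ℝ) {α : ℕ → ℕ → ℝ≥0∞}
    (hα : ∀ r ≤ 2, ∀ m, momentNorm P m (baseNorm f L R r) ≤ α r m) :
    ∫⁻ ω, ‖∑ a, ∑ b, M a b * hessCoeff h f L a b (R ω)‖ₑ ∂P ≤
      ENNReal.ofReal √(∑ a, ∑ b, M a b ^ 2) * lambdaOne α := by
  have hm := measurable_baseNorm hf L hR
  have h0 := hm 0 (by norm_num)
  have h1 := hm 1 (by norm_num)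
  have h2 := hm 2 (by norm_num)
  refine le_trans (lintegral_mono fun ω => ?_) ((lintegral_const_mul _ ?_).trans_le
    (mul_le_mul_right (lintegral_le_lambdaOne hm hα) _))
  · rw [← ofReal_norm]
    refine (ENNReal.ofReal_le_ofReal (sum_norm_mul_hessCoeff_le hh hf L (R ω) M)).trans ?_
    have n1 := flatNorm_nonneg (iteratedFDeriv ℝ 1 (fun w => f (R ω + L w)) 0)
    have n2 := flatNorm_nonneg (iteratedFDeriv ℝ 2 (fun w => f (R ω + L w)) 0)
    have e0 : ‖f (R ω)‖ = flatNorm (iteratedFDeriv ℝ 0 (fun w => f (R ω + L w)) 0) := by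
      simp [flatNorm_iteratedFDeriv_zero]
    have n0 := flatNorm_nonneg (iteratedFDeriv ℝ 0 (fun w => f (R ω + L w)) 0)
    rw [e0, ENNReal.ofReal_mul (by positivity), ENNReal.ofReal_add (by positivity) (by positivity),
      ENNReal.ofReal_mul (by positivity), ENNReal.ofReal_mul (by positivity),
      ENNReal.ofReal_add (by positivity) (by positivity),
      ENNReal.ofReal_add (by positivity) (by positivity),
      ENNReal.ofReal_add (by positivity) (by positivity),
      ENNReal.ofReal_pow n0, ENNReal.ofReal_pow n1, ENNReal.ofReal_one]
    rfl
  · fun_prop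

lemma integrable_hessCoeff {h : F → ℝ} (hh : TestBounds h) {f : A → F}
    (hf : ThriceDifferentiable f) (L : EuclideanSpace ℝ ι →L[ℝ] A) {R : Ω → A}
    (hR : Measurable R) {α : ℕ → ℕ → ℝ≥0∞}
    (hα : ∀ r ≤ 2, ∀ m, momentNorm P m (baseNorm f L R r) ≤ α r m) (h1 : lambdaOne α ≠ ∞)
    (a b : ι) : Integrable (fun ω => hessCoeff h f L a b (R ω)) P := by
  -- The matrix unit at `(a, b)` isolates a single Hessian coefficient.
  have := lintegral_sum_mul_hessCoeff_le hh hf L hR (Pi.single a (Pi.single b 1)) hα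
  refine ⟨((continuous_hessCoeff hh.thrice hf L a b).measurable.comp hR).aestronglyMeasurable,
    lt_of_le_of_lt (le_trans (le_of_eq ?_) this)
      (ENNReal.mul_lt_top ENNReal.ofReal_lt_top h1.lt_top)⟩
  refine lintegral_congr fun ω => ?_
  rw [Finset.sum_eq_single a, Finset.sum_eq_single b]
  · simp
  · intro c _ hc
    simp [hc]
  · simp
  · intro c _ hc
    simp [hc]
  · simp

/-- The products bounding the gradient do not occur in `lambdaOne`, hence the assumption that the
moments themselves are finite. -/
lemma integrable_gradCoeff {h : F → ℝ} (hh : TestBounds h) {f : A → F}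
    (hf : ThriceDifferentiable f) (L : EuclideanSpace ℝ ι →L[ℝ] A) {R : Ω → A}
    (hR : Measurable R) {α : ℕ → ℕ → ℝ≥0∞}
    (hα : ∀ r ≤ 2, ∀ m, momentNorm P m (baseNorm f L R r) ≤ α r m)
    (hfin : ∀ r ≤ 2, ∀ m ≤ 6, α r m ≠ ∞)
    (a : ι) : Integrable (fun ω => gradCoeff h f L a (R ω)) P := by
  refine ⟨((continuous_gradCoeff hh.thrice hf L a).measurable.comp hR).aestronglyMeasurable, ?_⟩
  have hm := measurable_baseNorm hf L hR
  have h0 := hm 0 (by norm_num)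
  have h1 := hm 1 (by norm_num)
  have hne : ∀ r ≤ 2, ∀ m ≤ 6, momentNorm P m (baseNorm f L R r) ≠ ∞ := fun r hr m hm' =>
    ne_top_of_le_ne_top (hfin r hr m hm') (hα r hr m)
  refine lt_of_le_of_lt (lintegral_mono (g := fun ω => baseNorm f L R 1 ω +
    (baseNorm f L R 0 ω * baseNorm f L R 1 ω +
      baseNorm f L R 0 ω * baseNorm f L R 0 ω * baseNorm f L R 1 ω)) fun ω => ?_) ?_
  · have := norm_gradCoeff_le hh hf L (R ω) a
    rw [← ofReal_norm]
    refine (ENNReal.ofReal_le_ofReal this).trans ?_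
    have n1 := flatNorm_nonneg (iteratedFDeriv ℝ 1 (fun w => f (R ω + L w)) 0)
    have e0 : ‖f (R ω)‖ = flatNorm (iteratedFDeriv ℝ 0 (fun w => f (R ω + L w)) 0) := by
      simp [flatNorm_iteratedFDeriv_zero]
    have n0 := flatNorm_nonneg (iteratedFDeriv ℝ 0 (fun w => f (R ω + L w)) 0)
    rw [e0, ENNReal.ofReal_mul (by positivity),
      ENNReal.ofReal_add (by positivity) (by positivity),
      ENNReal.ofReal_add (by positivity) (by positivity),
      ENNReal.ofReal_pow n0, ENNReal.ofReal_one]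
    refine le_of_eq ?_
    change (1 + baseNorm f L R 0 ω + baseNorm f L R 0 ω ^ 2) * baseNorm f L R 1 ω = _
    ring
  · rw [lintegral_add_left h1, lintegral_add_left (by fun_prop)]
    refine ENNReal.add_lt_top.2 ⟨?_, ENNReal.add_lt_top.2 ⟨?_, ?_⟩⟩
    · rw [lintegral_eq_momentNorm_one]
      exact (hne 1 (by norm_num) 1 (by norm_num)).lt_top
    · exact (lintegral_mul_le_momentNorm h0 h1).trans_lt (ENNReal.mul_lt_top
        (hne 0 (by norm_num) 2 (by norm_num)).lt_top (hne 1 (by norm_num) 2 (by norm_num)).lt_top)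
    · exact (lintegral_mul₃_le_momentNorm h0 h0 h1).trans_lt (ENNReal.mul_lt_top
        (ENNReal.mul_lt_top (hne 0 (by norm_num) 3 (by norm_num)).lt_top
          (hne 0 (by norm_num) 3 (by norm_num)).lt_top) (hne 1 (by norm_num) 3 (by norm_num)).lt_top)

lemma lambdaOne_ne_top {α : ℕ → ℕ → ℝ≥0∞} (h : ∀ r ≤ 3, ∀ m ≤ 6, α r m ≠ ∞) :
    lambdaOne α ≠ ∞ := by
  have h02 := h 0 (by norm_num) 2 (by norm_num)
  have h03 := h 0 (by norm_num) 3 (by norm_num)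
  have h12 := h 1 (by norm_num) 2 (by norm_num)
  have h13 := h 1 (by norm_num) 3 (by norm_num)
  have h21 := h 2 (by norm_num) 1 (by norm_num)
  have h22 := h 2 (by norm_num) 2 (by norm_num)
  have h23 := h 2 (by norm_num) 3 (by norm_num)
  unfold lambdaOne
  finiteness

lemma enorm_le_segmentSup_zero (f : A → F) (L : EuclideanSpace ℝ ι →L[ℝ] A) (R : Ω → A)
    (V : Ω → EuclideanSpace ℝ ι) (ω : Ω) :
    ‖f (R ω + L (V ω))‖ₑ ≤ segmentSup f L R V 0 ω := by
  have := le_segmentSup f L R V 0 ω (t := 1) (by simp)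
  rwa [one_smul, flatNorm_iteratedFDeriv_zero, ofReal_norm] at this

variable [SecondCountableTopology A]

/-- The exact second-order expansion of `𝔼 h(f(R + L V))` for `V` independent of `R`. -/
lemma integral_eq_expansion [IsProbabilityMeasure P] {h : F → ℝ} (hh : TestBounds h) {f : A → F}
    (hf : ThriceDifferentiable f) (L : EuclideanSpace ℝ ι →L[ℝ] A) {R : Ω → A}
    (hR : Measurable R) {V : Ω → EuclideanSpace ℝ ι} (hV : Measurable V)
    (hVR : IndepFun V R P) (hV2 : ∀ a, MemLp (fun ω => V ω a) 2 P) {α : ℕ → ℕ → ℝ≥0∞}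
    (hα : ∀ r ≤ 3, ∀ m, momentNorm P m (segmentSup f L R V r) ≤ α r m)
    (hfin : ∀ r ≤ 3, ∀ m ≤ 6, α r m ≠ ∞) :
    ∫ ω, h (f (R ω + L (V ω))) ∂P = ∫ ω, h (f (R ω)) ∂P +
      ∑ a, (∫ ω, V ω a ∂P) * ∫ ω, gradCoeff h f L a (R ω) ∂P +
      (∑ a, ∑ b, (∫ ω, V ω a * V ω b ∂P) * ∫ ω, hessCoeff h f L a b (R ω) ∂P) / 2 +
      ∫ ω, taylorRemainder h f L (R ω) (V ω) ∂P := by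
  have hb : ∀ r ≤ 2, ∀ m, momentNorm P m (baseNorm f L R r) ≤ α r m := fun r hr m =>
    (momentNorm_mono (baseNorm_le_segmentSup f L R V r)).trans (hα r (by omega) m)
  have hLV : Measurable fun ω => f (R ω + L (V ω)) :=
    hf.1.continuous.measurable.comp (hR.add (L.continuous.measurable.comp hV))
  have i1 : Integrable (fun ω => h (f (R ω + L (V ω)))) P :=
    hh.integrable_comp hLV (ne_top_of_le_ne_top (hfin 0 (by norm_num) 6 le_rfl)
      ((momentNorm_mono (enorm_le_segmentSup_zero f L R V)).trans (hα 0 (by norm_num) 6)))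
  have i2 : Integrable (fun ω => h (f (R ω))) P := by
    refine hh.integrable_comp (hf.1.continuous.measurable.comp hR)
      (ne_top_of_le_ne_top (hfin 0 (by norm_num) 6 le_rfl)
      ((momentNorm_mono fun ω => ?_).trans (hb 0 (by norm_num) 6)))
    rw [baseNorm, flatNorm_iteratedFDeriv_zero, map_zero, add_zero, ofReal_norm]
  have hVm : ∀ a, Measurable fun v : EuclideanSpace ℝ ι => v a := fun a => by fun_prop
  have hVmm : ∀ a b, Measurable fun v : EuclideanSpace ℝ ι => v a * v b :=
    fun a b => (hVm a).mul (hVm b)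
  have hgm := fun a => (continuous_gradCoeff hh.thrice hf L a).measurable
  have hhm := fun a b => (continuous_hessCoeff hh.thrice hf L a b).measurable
  -- The coefficients are continuous functions of `R` alone, so they are independent of the
  -- coordinates of `V`; this gives both integrability of the products and their factorisation.
  have ind1 : ∀ a, IndepFun (fun ω => V ω a) (fun ω => gradCoeff h f L a (R ω)) P :=
    fun a => hVR.comp (hVm a) (hgm a)
  have ind2 : ∀ a b, IndepFun (fun ω => V ω a * V ω b) (fun ω => hessCoeff h f L a b (R ω)) P :=
    fun a b => hVR.comp (hVmm a b) (hhm a b)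
  have ig := integrable_gradCoeff hh hf L hR hb fun r hr => hfin r (by omega)
  have ih := integrable_hessCoeff hh hf L hR hb (lambdaOne_ne_top hfin)
  have j1 : ∀ a, Integrable (fun ω => V ω a * gradCoeff h f L a (R ω)) P := fun a =>
    (ind1 a).integrable_mul ((hV2 a).integrable one_le_two) (ig a)
  have j2 : ∀ a b, Integrable (fun ω => V ω a * V ω b * hessCoeff h f L a b (R ω)) P :=
    fun a b => (ind2 a b).integrable_mul ((hV2 a).integrable_mul (hV2 b)) (ih a b)
  have k1 := integrable_finsetSum Finset.univ fun a _ => j1 a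
  have k2 := (integrable_finsetSum Finset.univ fun a _ =>
    integrable_finsetSum Finset.univ fun b _ => j2 a b).div_const 2
  have e : ∫ ω, taylorRemainder h f L (R ω) (V ω) ∂P = ∫ ω, h (f (R ω + L (V ω))) ∂P -
      ∫ ω, h (f (R ω)) ∂P - ∫ ω, ∑ a, V ω a * gradCoeff h f L a (R ω) ∂P -
      ∫ ω, (∑ a, ∑ b, V ω a * V ω b * hessCoeff h f L a b (R ω)) / 2 ∂P := by
    have i12 : Integrable (fun ω => h (f (R ω + L (V ω))) - h (f (R ω))) P := i1.sub i2
    have i123 : Integrable (fun ω => h (f (R ω + L (V ω))) - h (f (R ω)) -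
      ∑ a, V ω a * gradCoeff h f L a (R ω)) P := i12.sub k1
    rw [← integral_sub i1 i2, ← integral_sub i12 k1, ← integral_sub i123 k2]
    rfl
  rw [e, integral_div, integral_finsetSum _ fun a _ => j1 a,
    integral_finsetSum _ fun a _ => integrable_finsetSum Finset.univ fun b _ => j2 a b]
  have e1 : ∀ a, ∫ ω, V ω a * gradCoeff h f L a (R ω) ∂P =
      (∫ ω, V ω a ∂P) * ∫ ω, gradCoeff h f L a (R ω) ∂P := fun a =>
    (ind1 a).integral_fun_mul_eq_mul_integral ((hVm a).comp hV).aestronglyMeasurable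
      ((hgm a).comp hR).aestronglyMeasurable
  have e2 : ∀ a, ∫ ω, ∑ b, V ω a * V ω b * hessCoeff h f L a b (R ω) ∂P =
      ∑ b, (∫ ω, V ω a * V ω b ∂P) * ∫ ω, hessCoeff h f L a b (R ω) ∂P := fun a => by
    rw [integral_finsetSum _ fun b _ => j2 a b]
    exact Finset.sum_congr rfl fun b _ =>
      (ind2 a b).integral_fun_mul_eq_mul_integral ((hVmm a b).comp hV).aestronglyMeasurable
        ((hhm a b).comp hR).aestronglyMeasurable
  simp only [e1, e2]
  ring

/-- Replacing `V` by `V'` with the same mean, both independent of `R`. -/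
lemma enorm_integral_sub_integral_le [IsProbabilityMeasure P] {h : F → ℝ} (hh : TestBounds h)
    {f : A → F} (hf : ThriceDifferentiable f) (L : EuclideanSpace ℝ ι →L[ℝ] A) {R : Ω → A}
    (hR : Measurable R) {V V' : Ω → EuclideanSpace ℝ ι} (hV : Measurable V) (hV' : Measurable V')
    (hVR : IndepFun V R P) (hVR' : IndepFun V' R P)
    (hV2 : ∀ a, MemLp (fun ω => V ω a) 2 P) (hV2' : ∀ a, MemLp (fun ω => V' ω a) 2 P)
    (hmean : ∀ a, ∫ ω, V ω a ∂P = ∫ ω, V' ω a ∂P) {M : ι → ι → ℝ}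
    (hM : ∀ a b, ∫ ω, V ω a * V ω b ∂P - ∫ ω, V' ω a * V' ω b ∂P = M a b) {α : ℕ → ℕ → ℝ≥0∞}
    (hα : ∀ r ≤ 3, ∀ m, momentNorm P m (segmentSup f L R V r) ≤ α r m)
    (hα' : ∀ r ≤ 3, ∀ m, momentNorm P m (segmentSup f L R V' r) ≤ α r m)
    (hfin : ∀ r ≤ 3, ∀ m ≤ 6, α r m ≠ ∞) :
    ‖∫ ω, h (f (R ω + L (V ω))) ∂P - ∫ ω, h (f (R ω + L (V' ω))) ∂P‖ₑ ≤
      ENNReal.ofReal √(∑ a, ∑ b, M a b ^ 2) * lambdaOne α +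
      (lambdaTwo α * momentNorm P 2 (fun ω => ‖V ω‖ₑ ^ 3) +
        lambdaTwo α * momentNorm P 2 (fun ω => ‖V' ω‖ₑ ^ 3)) := by
  have hb : ∀ r ≤ 2, ∀ m, momentNorm P m (baseNorm f L R r) ≤ α r m := fun r hr m =>
    (momentNorm_mono (baseNorm_le_segmentSup f L R V r)).trans (hα r (by omega) m)
  have ih := integrable_hessCoeff hh hf L hR hb (lambdaOne_ne_top hfin)
  -- With a common base point, orders zero and one cancel; only the defect `M` of second moments and
  -- the two remainders survive.
  have e : ∫ ω, h (f (R ω + L (V ω))) ∂P - ∫ ω, h (f (R ω + L (V' ω))) ∂P =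
      (∫ ω, ∑ a, ∑ b, M a b * hessCoeff h f L a b (R ω) ∂P) / 2 +
        (∫ ω, taylorRemainder h f L (R ω) (V ω) ∂P -
          ∫ ω, taylorRemainder h f L (R ω) (V' ω) ∂P) := by
    rw [integral_eq_expansion hh hf L hR hV hVR hV2 hα hfin,
      integral_eq_expansion hh hf L hR hV' hVR' hV2' hα' hfin,
      integral_finsetSum _ fun a _ => integrable_finsetSum Finset.univ fun b _ =>
        (ih a b).const_mul _]
    have e2 : ∀ a, ∫ ω, ∑ b, M a b * hessCoeff h f L a b (R ω) ∂P =
        ∑ b, (∫ ω, V ω a * V ω b ∂P) * ∫ ω, hessCoeff h f L a b (R ω) ∂P -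
        ∑ b, (∫ ω, V' ω a * V' ω b ∂P) * ∫ ω, hessCoeff h f L a b (R ω) ∂P := fun a => by
      rw [integral_finsetSum _ fun b _ => (ih a b).const_mul _, ← Finset.sum_sub_distrib]
      refine Finset.sum_congr rfl fun b _ => ?_
      rw [integral_const_mul, ← hM, sub_mul]
    simp only [e2, Finset.sum_sub_distrib, hmean]
    ring
  rw [e]
  refine (enorm_add_le _ _).trans (add_le_add ?_ ((enorm_sub_le).trans (add_le_add ?_ ?_)))
  · rw [div_eq_mul_inv, enorm_mul]
    refine (mul_le_of_le_one_right' ?_).trans ((enorm_integral_le_lintegral_enorm _).trans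
      (lintegral_sum_mul_hessCoeff_le hh hf L hR M hb))
    rw [← ofReal_norm]
    refine ENNReal.ofReal_le_one.2 ?_
    norm_num
  · exact (enorm_integral_le_lintegral_enorm _).trans
      (lintegral_taylorRemainder_le hh hf L hR hV hα)
  · exact (enorm_integral_le_lintegral_enorm _).trans
      (lintegral_taylorRemainder_le hh hf L hR hV' hα')

end Expectation

/-! ### Regrouping independent random elements. -/

section Independence

variable {Ω α β γ δ : Type*} [MeasurableSpace Ω] {P : Measure Ω} [IsProbabilityMeasure P]
  [MeasurableSpace α] [MeasurableSpace β] [MeasurableSpace γ] [MeasurableSpace δ]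
  {A : Ω → α} {B : Ω → β} {C : Ω → γ} {D : Ω → δ}

/-- The joint law is the product of the four marginals, and reassociating and swapping the middle
factors preserves product measures. -/
lemma indepFun_prodMk_prodMk (hA : Measurable A) (hB : Measurable B) (hC : Measurable C)
    (hD : Measurable D) (hAB : IndepFun A B P) (hCD : IndepFun C D P)
    (h : IndepFun (fun ω => (A ω, B ω)) (fun ω => (C ω, D ω)) P) :
    IndepFun (fun ω => (A ω, C ω)) (fun ω => (B ω, D ω)) P := by
  have hAC : IndepFun A C P := h.comp measurable_fst measurable_fst
  have hBD : IndepFun B D P := h.comp measurable_snd measurable_snd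
  have pA := Measure.isProbabilityMeasure_map (μ := P) hA.aemeasurable
  have pB := Measure.isProbabilityMeasure_map (μ := P) hB.aemeasurable
  have pC := Measure.isProbabilityMeasure_map (μ := P) hC.aemeasurable
  have pD := Measure.isProbabilityMeasure_map (μ := P) hD.aemeasurable
  rw [indepFun_iff_map_prod_eq_prod_map_map (by fun_prop) (by fun_prop)] at hAB hCD hAC hBD h ⊢
  rw [hAB, hCD] at h
  rw [hAC, hBD]
  set a := P.map A
  set b := P.map B
  set c := P.map C
  set d := P.map D
  have m1 := measurePreserving_prodAssoc a b (c.prod d)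
  have m2 := (measurePreserving_prodAssoc b c d).symm MeasurableEquiv.prodAssoc
  have m3 := (Measure.measurePreserving_swap (μ := b) (ν := c)).prod (MeasurePreserving.id d)
  have m4 := measurePreserving_prodAssoc c b d
  have m5 := (MeasurePreserving.id a).prod ((m4.comp m3).comp m2)
  have m6 := (measurePreserving_prodAssoc a c (b.prod d)).symm MeasurableEquiv.prodAssoc
  have m := (m6.comp m5).comp m1
  rw [← m.map_eq, ← h, Measure.map_map m.measurable (by fun_prop)]
  rfl

/-- The preceding regrouping with a constant in the third slot. -/
lemma indepFun_prodMk_right (hA : Measurable A) (hB : Measurable B) (hC : Measurable C)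
    (hAB : IndepFun A B P) (h : IndepFun (fun ω => (A ω, B ω)) C P) :
    IndepFun A (fun ω => (B ω, C ω)) P := by
  have h1 : IndepFun (fun ω => (A ω, B ω)) (fun ω => (PUnit.unit.{1}, C ω)) P :=
    h.comp measurable_id (measurable_const.prodMk measurable_id)
  exact (indepFun_prodMk_prodMk hA hB measurable_const hC hAB
    (indepFun_const_left _ _) h1).comp measurable_fst measurable_id

end Independence

/-! ### Sixth moments of high-dimensional blocks. -/

section SixthMoment

variable {Ω : Type*} [MeasurableSpace Ω] {P : Measure Ω}

/-- The power mean inequality with exponent three, applied to the squared coordinates. -/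
lemma enorm_pow_six_le {ι : Type*} [Fintype ι] (v : EuclideanSpace ℝ ι) :
    ‖v‖ₑ ^ 6 ≤ (Fintype.card ι : ℝ≥0∞) ^ 2 * ∑ a, ‖v a‖ₑ ^ 6 := by
  have h1 : ‖v‖ ^ 6 ≤ (Fintype.card ι : ℝ) ^ 2 * ∑ a, ‖v a‖ ^ 6 := by
    have h2 := pow_sum_le_card_mul_sum_pow (s := Finset.univ) (f := fun a => ‖v a‖ ^ 2)
      (fun a _ => by positivity) 2
    simp only [← EuclideanSpace.norm_sq_eq, ← pow_mul, Finset.card_univ] at h2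
    exact h2
  simp only [← coe_nnnorm] at h1
  simp only [enorm_eq_nnnorm]
  exact_mod_cast h1

/-- Source of the factor `k ^ (3/2)`: with `kd` coordinates the sixth moment is at most `(kd)² · kd
· C`, and the `L_2` norm takes a square root. -/
lemma momentNorm_norm_pow_three_le {k d : ℕ} {V : Ω → Block k d} (hV : Measurable V) {C : ℝ≥0∞}
    (hC : ∀ a, ∫⁻ ω, ‖V ω a‖ₑ ^ 6 ∂P ≤ C) :
    momentNorm P 2 (fun ω => ‖V ω‖ₑ ^ 3) ≤
      (k : ℝ≥0∞) ^ (3 / 2 : ℝ) * ((d : ℝ≥0∞) ^ 3 * C) ^ (1 / 2 : ℝ) := by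
  have h1 : ∫⁻ ω, ‖V ω‖ₑ ^ 6 ∂P ≤ (k : ℝ≥0∞) ^ 3 * ((d : ℝ≥0∞) ^ 3 * C) := by
    calc _ ≤ ∫⁻ ω, (Fintype.card (Fin k × Fin d) : ℝ≥0∞) ^ 2 * ∑ a, ‖V ω a‖ₑ ^ 6 ∂P :=
          lintegral_mono fun ω => enorm_pow_six_le _
      _ = (Fintype.card (Fin k × Fin d) : ℝ≥0∞) ^ 2 * ∑ a, ∫⁻ ω, ‖V ω a‖ₑ ^ 6 ∂P := by
          rw [lintegral_const_mul _ (by fun_prop), lintegral_finsetSum _ (by fun_prop)]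
      _ ≤ (Fintype.card (Fin k × Fin d) : ℝ≥0∞) ^ 2 * ∑ a : Fin k × Fin d, C := by
          gcongr with a
          exact hC a
      _ = _ := by
          simp
          ring
  have h2 : ∀ x : ℝ≥0∞, (x ^ 3) ^ (1 / 2 : ℝ) = x ^ (3 / 2 : ℝ) := fun x => by
    rw [← ENNReal.rpow_natCast, ← ENNReal.rpow_mul]
    norm_num
  rw [momentNorm, ← h2, ← ENNReal.mul_rpow_of_nonneg _ _ (by positivity)]
  push_cast
  gcongr
  refine le_trans (le_of_eq ?_) h1
  refine lintegral_congr fun ω => ?_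
  rw [← pow_mul]

end SixthMoment

/-! ### Moments of the augmented data and of their surrogates. -/

section Model

variable {Ω : Type*} [MeasurableSpace Ω] {P : Measure Ω} [IsProbabilityMeasure P] {d : ℕ}
  {T : Set (EuclideanSpace ℝ (Fin d) → EuclideanSpace ℝ (Fin d))} [MeasurableSpace T]

/-- I.i.d. observations with i.i.d. transformations, independent of each other. -/
structure IsAugmentedSample (P : Measure Ω) (X : ℕ → Ω → EuclideanSpace ℝ (Fin d))
    (φ : ℕ → ℕ → Ω → T) : Prop where
  measurable_eval : Measurable fun p : T × EuclideanSpace ℝ (Fin d) => p.1.1 p.2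
  measurable_data : ∀ i, Measurable (X i)
  iIndepFun_data : iIndepFun X P
  identDistrib_data : ∀ i, IdentDistrib (X i) (X 0) P P
  measurable_map : ∀ i j, Measurable (φ i j)
  iIndepFun_map : iIndepFun (fun ij : ℕ × ℕ => φ ij.1 ij.2) P
  identDistrib_map : ∀ i j, IdentDistrib (φ i j) (φ 0 0) P P
  indepFun : IndepFun (fun ω i => X i ω) (fun ω (ij : ℕ × ℕ) => φ ij.1 ij.2 ω) P
  memLp : MemLp (transformed (φ 0 0) (X 0)) 6 P

/-- I.i.d. Gaussian vectors with the mean and covariance of the surrogates, independent of the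
augmented sample. -/
structure IsGaussianSurrogate (P : Measure Ω) (X : ℕ → Ω → EuclideanSpace ℝ (Fin d))
    (φ : ℕ → ℕ → Ω → T) {k : ℕ} (Z : ℕ → Ω → Block k d) : Prop where
  measurable : ∀ i, Measurable (Z i)
  iIndepFun : iIndepFun Z P
  hasGaussianLaw : ∀ i, HasGaussianLaw (Z i) P
  integral_eq : ∀ i, ∫ ω, Z i ω ∂P =
      WithLp.toLp 2 fun jl => (∫ ω, transformed (φ 0 0) (X 0) ω ∂P) jl.2
  covMat_eq : ∀ i, covMat P (Z i) (Z i) =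
      (Matrix.of fun _ _ => (1 : ℝ)) ⊗ₖ
        covMat P (transformed (φ 0 0) (X 0)) (transformed (φ 0 1) (X 0))
  indepFun : IndepFun (fun ω => ((fun i => X i ω), (fun ij : ℕ × ℕ => φ ij.1 ij.2 ω)))
      (fun ω i => Z i ω) P

variable {X : ℕ → Ω → EuclideanSpace ℝ (Fin d)} {φ : ℕ → ℕ → Ω → T}

namespace IsAugmentedSample

lemma measurable_transformed (S : IsAugmentedSample P X φ) (i j : ℕ) :
    Measurable (transformed (φ i j) (X i)) :=
  S.measurable_eval.comp ((S.measurable_map i j).prodMk (S.measurable_data i))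

lemma measurable_augmented (S : IsAugmentedSample P X φ) (k i : ℕ) :
    Measurable (augmented φ X k i) := by
  refine (WithLp.measurable_toLp 2 _).comp (measurable_pi_lambda _ fun jl => ?_)
  have := S.measurable_transformed i jl.1
  fun_prop

lemma identDistrib_transformed (S : IsAugmentedSample P X φ) (i j : ℕ) :
    IdentDistrib (transformed (φ i j) (X i)) (transformed (φ 0 0) (X 0)) P P := by
  have hi : ∀ i j, IndepFun (φ i j) (X i) P := fun i j =>
    (S.indepFun.comp (measurable_pi_apply i) (measurable_pi_apply (i, j))).symm
  exact ((S.identDistrib_map i j).prodMk (S.identDistrib_data i) (hi i j) (hi 0 0)).comp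
    S.measurable_eval

/-- For distinct `j`, `j'` the two maps are independent of each other and jointly independent of `X
i`, which fixes the joint law. -/
lemma identDistrib_transformed_pair (S : IsAugmentedSample P X φ) (i : ℕ) {j j' : ℕ}
    (hj : j ≠ j') :
    IdentDistrib (fun ω => (transformed (φ i j) (X i) ω, transformed (φ i j') (X i) ω))
      (fun ω => (transformed (φ 0 0) (X 0) ω, transformed (φ 0 1) (X 0) ω)) P P := by
  have hi : ∀ i j j', IndepFun (fun ω => (φ i j ω, φ i j' ω)) (X i) P := fun i j j' =>
    (S.indepFun.comp (measurable_pi_apply i)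
      ((measurable_pi_apply (i, j)).prodMk (measurable_pi_apply (i, j')))).symm
  have hp : IdentDistrib (fun ω => (φ i j ω, φ i j' ω)) (fun ω => (φ 0 0 ω, φ 0 1 ω)) P P :=
    (S.identDistrib_map i j).prodMk ((S.identDistrib_map i j').trans (S.identDistrib_map 0 1).symm)
      (S.iIndepFun_map.indepFun (i := (i, j)) (j := (i, j')) (by simpa using hj))
      (S.iIndepFun_map.indepFun (i := (0, 0)) (j := (0, 1)) (by simp))
  refine (hp.prodMk (S.identDistrib_data i) (hi i j j') (hi 0 0 1)).comp
    (u := fun p : (T × T) × EuclideanSpace ℝ (Fin d) => (p.1.1.1 p.2, p.1.2.1 p.2)) ?_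
  exact (S.measurable_eval.comp (measurable_fst.fst.prodMk measurable_snd)).prodMk
    (S.measurable_eval.comp (measurable_fst.snd.prodMk measurable_snd))

lemma memLp_transformed_apply (S : IsAugmentedSample P X φ) (i j : ℕ) (l : Fin d) :
    MemLp (fun ω => transformed (φ i j) (X i) ω l) 6 P := by
  have h : MemLp (transformed (φ i j) (X i)) 6 P := (S.identDistrib_transformed i j).memLp_iff.2
    S.memLp
  refine h.mono (by have := S.measurable_transformed i j; fun_prop)
    (Eventually.of_forall fun ω => PiLp.norm_apply_le _ _)

lemma integral_transformed_apply (S : IsAugmentedSample P X φ) (i j : ℕ) (l : Fin d) :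
    ∫ ω, transformed (φ i j) (X i) ω l ∂P = (∫ ω, transformed (φ 0 0) (X 0) ω ∂P) l := by
  have h1 : ∫ ω, transformed (φ i j) (X i) ω l ∂P = ∫ ω, transformed (φ 0 0) (X 0) ω l ∂P :=
    ((S.identDistrib_transformed i j).comp (u := fun x : EuclideanSpace ℝ (Fin d) => x l)
      (by fun_prop)).integral_eq
  rw [h1]
  exact ContinuousLinearMap.integral_comp_comm (EuclideanSpace.proj (𝕜 := ℝ) l)
    (S.memLp.integrable (by norm_num))

lemma memLp_augmented_apply (S : IsAugmentedSample P X φ) (k i : ℕ) (a : Fin k × Fin d) :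
    MemLp (fun ω => augmented φ X k i ω a) 6 P :=
  S.memLp_transformed_apply i a.1 a.2

lemma integral_augmented_mul (S : IsAugmentedSample P X φ) (k i : ℕ) (a b : Fin k × Fin d) :
    ∫ ω, augmented φ X k i ω a * augmented φ X k i ω b ∂P =
      if a.1 = b.1 then
        ∫ ω, transformed (φ 0 0) (X 0) ω a.2 * transformed (φ 0 0) (X 0) ω b.2 ∂P
      else ∫ ω, transformed (φ 0 0) (X 0) ω a.2 * transformed (φ 0 1) (X 0) ω b.2 ∂P := by
  split_ifs with h
  · have := ((S.identDistrib_transformed i a.1).comp (u := fun x : EuclideanSpace ℝ (Fin d) => x a.2 * x b.2)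
      (by fun_prop)).integral_eq
    refine Eq.trans (integral_congr_ae (.of_forall fun ω => ?_)) this
    simp [augmented, h]
  · exact ((S.identDistrib_transformed_pair i (j := a.1) (j' := b.1)
      (by simpa [Fin.ext_iff] using h)).comp
      (u := fun x : EuclideanSpace ℝ (Fin d) × EuclideanSpace ℝ (Fin d) => x.1 a.2 * x.2 b.2)
      (by fun_prop)).integral_eq

lemma lintegral_augmented_apply_le (S : IsAugmentedSample P X φ) (k i : ℕ) (a : Fin k × Fin d) :
    ∫⁻ ω, ‖augmented φ X k i ω a‖ₑ ^ 6 ∂P ≤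
      ∫⁻ ω, ‖transformed (φ 0 0) (X 0) ω‖ₑ ^ 6 ∂P := by
  have h := ((S.identDistrib_transformed i a.1).comp
    (u := fun x : EuclideanSpace ℝ (Fin d) => ‖x‖ₑ ^ 6) (by fun_prop)).lintegral_eq
  refine le_trans (lintegral_mono fun ω => ?_) h.le
  simp only [Function.comp_apply]
  gcongr
  rw [← ofReal_norm, ← ofReal_norm]
  exact ENNReal.ofReal_le_ofReal (PiLp.norm_apply_le (transformed (φ i a.1) (X i) ω) a.2)

lemma lintegral_transformed_ne_top (S : IsAugmentedSample P X φ) :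
    ∫⁻ ω, ‖transformed (φ 0 0) (X 0) ω‖ₑ ^ 6 ∂P ≠ ∞ := by
  have := lintegral_rpow_enorm_lt_top_of_eLpNorm_lt_top (p := 6) (by norm_num) (by norm_num)
    S.memLp.2
  have h6 : (6 : ℝ≥0∞).toReal = (6 : ℕ) := by norm_num
  simp only [h6, ENNReal.rpow_natCast] at this
  exact this.ne

end IsAugmentedSample

namespace IsGaussianSurrogate

variable {k : ℕ} {Z : ℕ → Ω → Block k d}

lemma hasGaussianLaw_apply (G : IsGaussianSurrogate P X φ Z) (i : ℕ) (a : Fin k × Fin d) :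
    HasGaussianLaw (fun ω => Z i ω a) P :=
  (G.hasGaussianLaw i).map_fun (EuclideanSpace.proj (𝕜 := ℝ) a)

lemma integral_apply (G : IsGaussianSurrogate P X φ Z) (i : ℕ) (a : Fin k × Fin d) :
    ∫ ω, Z i ω a ∂P = (∫ ω, transformed (φ 0 0) (X 0) ω ∂P) a.2 := by
  have h := congrArg (fun v : Block k d => v a) (G.integral_eq i)
  rw [← show (∫ ω, Z i ω ∂P) a = _ from h]
  exact ContinuousLinearMap.integral_comp_comm (EuclideanSpace.proj (𝕜 := ℝ) a)
    (G.hasGaussianLaw i).integrable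

lemma covariance_apply (G : IsGaussianSurrogate P X φ Z) (i : ℕ) (a b : Fin k × Fin d) :
    covariance (fun ω => Z i ω a) (fun ω => Z i ω b) P =
      covMat P (transformed (φ 0 0) (X 0)) (transformed (φ 0 1) (X 0)) a.2 b.2 := by
  have h := congrFun (congrFun (G.covMat_eq i) a) b
  simpa [covMat, Matrix.kroneckerMap_apply] using h

/-- The means coincide, so the prescribed covariance passes to uncentred second moments, in the
diagonal blocks too. -/
lemma integral_mul (S : IsAugmentedSample P X φ) (G : IsGaussianSurrogate P X φ Z) (i : ℕ)
    (a b : Fin k × Fin d) : ∫ ω, Z i ω a * Z i ω b ∂P =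
      ∫ ω, transformed (φ 0 0) (X 0) ω a.2 * transformed (φ 0 1) (X 0) ω b.2 ∂P := by
  have h := G.covariance_apply i a b
  rw [covMat, Matrix.of_apply, covariance_eq_sub (G.hasGaussianLaw_apply i a).memLp_two
    (G.hasGaussianLaw_apply i b).memLp_two, covariance_eq_sub
    ((S.memLp_transformed_apply 0 0 a.2).mono_exponent (by norm_num))
    ((S.memLp_transformed_apply 0 1 b.2).mono_exponent (by norm_num)), G.integral_apply,
    G.integral_apply, S.integral_transformed_apply, S.integral_transformed_apply] at h
  simpa using h

/-- A bound for the sixth moments of all coordinates that does not depend on `k`. -/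
lemma lintegral_apply_le (G : IsGaussianSurrogate P X φ Z) (i : ℕ) (a : Fin k × Fin d) :
    ∫⁻ ω, ‖Z i ω a‖ₑ ^ 6 ∂P ≤ ∑ l : Fin d, ∫⁻ x, ‖x‖ₑ ^ 6 ∂(gaussianReal
      ((∫ ω, transformed (φ 0 0) (X 0) ω ∂P) l)
      (covMat P (transformed (φ 0 0) (X 0)) (transformed (φ 0 1) (X 0)) l l).toNNReal) := by
  have h := (G.hasGaussianLaw_apply i a).map_eq_gaussianReal
  rw [G.integral_apply, ← covariance_self (G.hasGaussianLaw_apply i a).aemeasurable,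
    G.covariance_apply] at h
  -- The law of a coordinate depends only on its position in `Fin d`, so summing over `l` removes
  -- the dependence on `a`.
  refine le_trans (le_of_eq ?_) (Finset.single_le_sum (f := fun l => ∫⁻ x, ‖x‖ₑ ^ 6 ∂(gaussianReal
      ((∫ ω, transformed (φ 0 0) (X 0) ω ∂P) l)
      (covMat P (transformed (φ 0 0) (X 0)) (transformed (φ 0 1) (X 0)) l l).toNNReal))
      (fun _ _ => zero_le) (Finset.mem_univ a.2))
  rw [← h, lintegral_map (by fun_prop) (by have := G.measurable i; fun_prop)]

end IsGaussianSurrogate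

lemma lintegral_gaussianReal_pow_six_ne_top (μ : ℝ) (v : NNReal) :
    ∫⁻ x, ‖x‖ₑ ^ 6 ∂(gaussianReal μ v) ≠ ∞ := by
  have h : MemLp id 6 (gaussianReal μ v) := memLp_id_gaussianReal 6
  have := lintegral_rpow_enorm_lt_top_of_eLpNorm_lt_top (p := 6) (by norm_num) (by norm_num) h.2
  have h6 : (6 : ℝ≥0∞).toReal = (6 : ℕ) := by norm_num
  simp only [h6, ENNReal.rpow_natCast, id] at this
  exact this.ne

end Model

/-! ### The interpolation path and its block derivatives. -/

section Interpolate

lemma interpolate_eq_add {n : ℕ} {B : Type*} [NormedAddCommGroup B] [NormedSpace ℝ B]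
    (y z : Fin n → B) (i : Fin n) (w : B) :
    interpolate y z i w =
      interpolate y z i 0 + ContinuousLinearMap.single ℝ (fun _ : Fin n => B) i w := by
  ext1 j
  rcases eq_or_ne j i with rfl | h
  · simp [interpolate]
  · simp [interpolate, h]

lemma update_interpolate {n : ℕ} {B : Type*} (y z : Fin n → B) (i : Fin n) (w w' : B) :
    Function.update (interpolate y z i w) i w' = interpolate y z i w' := by
  ext1 j
  rcases eq_or_ne j i with rfl | h
  · simp [interpolate]
  · simp [interpolate, h]

/-- `(y_1, …, y_m, z_{m+1}, …, z_n)`. -/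
def splice {n : ℕ} {B : Type*} (y z : Fin n → B) (m : ℕ) : Fin n → B :=
  fun j => if (j : ℕ) < m then y j else z j

/-- Together with `interpolate_right`, this identifies the two ends of replacement `i` as
consecutive splices, so that the sum telescopes; indices start at `0`, hence the shift by one. -/
lemma interpolate_left {n : ℕ} {B : Type*} (y z : Fin n → B) (i : Fin n) :
    interpolate y z i (y i) = splice y z (i + 1) := by
  ext1 j
  simp only [interpolate, splice, Fin.lt_def, Fin.ext_iff]
  split_ifs with h1 h2 h3 h4 h5
  · rfl
  · omega
  · rw [Fin.ext h3]
  · omega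
  · omega
  · rfl

lemma interpolate_right {n : ℕ} {B : Type*} (y z : Fin n → B) (i : Fin n) :
    interpolate y z i (z i) = splice y z i := by
  ext1 j
  simp only [interpolate, splice, Fin.lt_def, Fin.ext_iff]
  split_ifs with h1 h2
  · rfl
  · rw [Fin.ext h2]
  · rfl

variable {Ω : Type*} [MeasurableSpace Ω] {P : Measure Ω} {n k d q : ℕ}

/-- Updating block `i` of `W_i(w)` forgets `w`, so block derivatives are derivatives of `w ↦ f
(W_i(0) + L w)`. -/
lemma iSup_blockDeriv_eq_segmentSup (f : (Fin n → Block k d) → EuclideanSpace ℝ (Fin q))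
    (Y Z : Fin n → Ω → Block k d) (V : Ω → Block k d) (r : ℕ) (i : Fin n) (ω : Ω) :
    (⨆ w ∈ segment ℝ 0 (V ω), ENNReal.ofReal
      (flatNorm (blockDeriv r f i (interpolate (fun j => Y j ω) (fun j => Z j ω) i w)))) =
    segmentSup f (ContinuousLinearMap.single ℝ (fun _ : Fin n => Block k d) i)
      (fun ω => interpolate (fun j => Y j ω) (fun j => Z j ω) i 0) V r ω := by
  unfold segmentSup blockDeriv
  simp only [update_interpolate, ← interpolate_eq_add]
  simp [interpolate]

lemma momentNorm_segmentSup_le_noiseStability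
    (f : (Fin n → Block k d) → EuclideanSpace ℝ (Fin q)) (Y Z : Fin n → Ω → Block k d)
    (r m : ℕ) (i : Fin n) :
    momentNorm P m (segmentSup f (ContinuousLinearMap.single ℝ (fun _ : Fin n => Block k d) i)
      (fun ω => interpolate (fun j => Y j ω) (fun j => Z j ω) i 0) (Y i) r) ≤
        noiseStability P f Y Z r m ∧
    momentNorm P m (segmentSup f (ContinuousLinearMap.single ℝ (fun _ : Fin n => Block k d) i)
      (fun ω => interpolate (fun j => Y j ω) (fun j => Z j ω) i 0) (Z i) r) ≤
        noiseStability P f Y Z r m := by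
  unfold noiseStability
  constructor
  · refine le_iSup_of_le i (le_trans (le_of_eq ?_) (le_max_left _ _))
    exact congrArg (momentNorm P m)
      (funext fun ω => (iSup_blockDeriv_eq_segmentSup f Y Z (Y i) r i ω).symm)
  · refine le_iSup_of_le i (le_trans (le_of_eq ?_) (le_max_right _ _))
    exact congrArg (momentNorm P m)
      (funext fun ω => (iSup_blockDeriv_eq_segmentSup f Y Z (Z i) r i ω).symm)

lemma noiseStability_ne_top [IsFiniteMeasure P]
    (f : (Fin n → Block k d) → EuclideanSpace ℝ (Fin q)) (Y Z : Fin n → Ω → Block k d)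
    {r m : ℕ} (hm : m ≤ 6) (h : noiseStability P f Y Z r 6 ≠ ∞) :
    noiseStability P f Y Z r m ≠ ∞ := by
  rw [noiseStability, ← Finset.sup_univ_eq_iSup, ← lt_top_iff_ne_top,
    Finset.sup_lt_iff ENNReal.coe_lt_top] at h ⊢
  intro i hi
  have := max_lt_iff.1 (h i hi)
  exact max_lt (momentNorm_ne_top_of_le_six hm this.1.ne).lt_top
    (momentNorm_ne_top_of_le_six hm this.2.ne).lt_top

lemma measurable_interpolate {Y Z : Fin n → Ω → Block k d} (hY : ∀ j, Measurable (Y j))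
    (hZ : ∀ j, Measurable (Z j)) (i : Fin n) :
    Measurable fun ω => interpolate (fun j => Y j ω) (fun j => Z j ω) i 0 := by
  refine measurable_pi_lambda _ fun j => ?_
  unfold interpolate
  split_ifs
  exacts [hY j, measurable_const, hZ j]

end Interpolate

/-! ### Each replaced block is independent of the remaining blocks. -/

section Independence

variable {Ω : Type*} [MeasurableSpace Ω] {P : Measure Ω} [IsProbabilityMeasure P] {d k : ℕ}
  {T : Set (EuclideanSpace ℝ (Fin d) → EuclideanSpace ℝ (Fin d))} [MeasurableSpace T]
  {X : ℕ → Ω → EuclideanSpace ℝ (Fin d)} {φ : ℕ → ℕ → Ω → T} {Z : ℕ → Ω → Block k d}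

lemma IsAugmentedSample.measurable_eval_apply (S : IsAugmentedSample P X φ) {Ω' : Type*}
    [MeasurableSpace Ω'] {t : Ω' → T} {x : Ω' → EuclideanSpace ℝ (Fin d)} (ht : Measurable t)
    (hx : Measurable x) (l : Fin d) : Measurable fun p => (t p).1 (x p) l := by
  have := S.measurable_eval.comp (ht.prodMk hx)
  exact Measurable.comp (g := fun y : EuclideanSpace ℝ (Fin d) => y l) (by fun_prop) this

lemma indepFun_augmented_interpolate (S : IsAugmentedSample P X φ)
    (G : IsGaussianSurrogate P X φ Z) {n : ℕ} (i : Fin n) :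
    IndepFun (augmented φ X k i)
      (fun ω => interpolate (fun j : Fin n => augmented φ X k j ω) (fun j => Z j ω) i 0) P := by
  -- `A` and `C` generate `Φ_i X_i`; `B` and `D` generate the earlier augmented blocks. Regrouping
  -- `(A, B)`, `(C, D)` into `(A, C)`, `(B, D)` and then adjoining the Gaussian vectors gives the
  -- claim.
  let A : Ω → EuclideanSpace ℝ (Fin d) := X i
  let B : Ω → (Finset.range i) → EuclideanSpace ℝ (Fin d) := fun ω j => X j ω
  let C : Ω → (({(i : ℕ)} : Finset ℕ) ×ˢ Finset.range k : Finset (ℕ × ℕ)) → T :=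
    fun ω p => φ p.1.1 p.1.2 ω
  let D : Ω → (Finset.range i ×ˢ Finset.range k : Finset (ℕ × ℕ)) → T :=
    fun ω p => φ p.1.1 p.1.2 ω
  have mA : Measurable A := S.measurable_data i
  have mB : Measurable B := measurable_pi_lambda _ fun j => S.measurable_data j
  have mC : Measurable C := measurable_pi_lambda _ fun p => S.measurable_map _ _
  have mD : Measurable D := measurable_pi_lambda _ fun p => S.measurable_map _ _
  have hAB : IndepFun A B P :=
    (S.iIndepFun_data.indepFun_finset {(i : ℕ)} (Finset.range i) (by simp)
      S.measurable_data).comp (measurable_pi_apply (⟨(i : ℕ), by simp⟩ : ({(i : ℕ)} : Finset ℕ)))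
      measurable_id
  have hCD : IndepFun C D P :=
    S.iIndepFun_map.indepFun_finset _ _
      (Finset.disjoint_left.2 fun p hp hq => by
        simp only [Finset.mem_product, Finset.mem_singleton, Finset.mem_range] at hp hq
        omega) fun p => S.measurable_map _ _
  have hABCD : IndepFun (fun ω => (A ω, B ω)) (fun ω => (C ω, D ω)) P :=
    S.indepFun.comp (φ := fun x : ℕ → EuclideanSpace ℝ (Fin d) =>
        (x i, fun j : Finset.range i => x j))
      (ψ := fun t : ℕ × ℕ → T => ((fun p => t p.1, fun p => t p.1) :
        ((({(i : ℕ)} : Finset ℕ) ×ˢ Finset.range k : Finset (ℕ × ℕ)) → T) ×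
        ((Finset.range i ×ˢ Finset.range k : Finset (ℕ × ℕ)) → T)))
      (by fun_prop) (by fun_prop)
  have h1 := indepFun_prodMk_prodMk mA mB mC mD hAB hCD hABCD
  have h2 : IndepFun (fun ω => ((A ω, C ω), (B ω, D ω))) (fun ω i => Z i ω) P :=
    G.indepFun.comp (φ := fun p : (ℕ → EuclideanSpace ℝ (Fin d)) × (ℕ × ℕ → T) =>
      (((p.1 i, fun s => p.2 s.1), (fun j => p.1 j.1, fun s => p.2 s.1)) :
      ((EuclideanSpace ℝ (Fin d) × ((({(i : ℕ)} : Finset ℕ) ×ˢ Finset.range k :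
        Finset (ℕ × ℕ)) → T)) × ((Finset.range i → EuclideanSpace ℝ (Fin d)) ×
        ((Finset.range i ×ˢ Finset.range k : Finset (ℕ × ℕ)) → T)))))
      (by fun_prop) measurable_id
  have h3 := indepFun_prodMk_right (mA.prodMk mC) (mB.prodMk mD)
    (measurable_pi_lambda _ fun i => G.measurable i) h1 h2
  let u : EuclideanSpace ℝ (Fin d) × ((({(i : ℕ)} : Finset ℕ) ×ˢ Finset.range k :
      Finset (ℕ × ℕ)) → T) → Block k d := fun p => WithLp.toLp 2 fun jl =>
    (p.2 ⟨((i : ℕ), (jl.1 : ℕ)), by simp⟩).1 p.1 jl.2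
  let v : ((Finset.range i → EuclideanSpace ℝ (Fin d)) ×
      ((Finset.range i ×ˢ Finset.range k : Finset (ℕ × ℕ)) → T)) × (ℕ → Block k d) →
      (Fin n → Block k d) := fun p j =>
    if h : j < i then WithLp.toLp 2 fun jl =>
      (p.1.2 ⟨((j : ℕ), (jl.1 : ℕ)), by simpa using h⟩).1 (p.1.1 ⟨(j : ℕ), by simpa using h⟩) jl.2
    else if j = i then 0 else p.2 j
  have hu : Measurable u := by
    refine (WithLp.measurable_toLp 2 _).comp (measurable_pi_lambda _ fun jl => ?_)
    exact S.measurable_eval_apply (by fun_prop) measurable_fst jl.2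
  have hv : Measurable v := by
    refine measurable_pi_lambda _ fun j => ?_
    simp only [v]
    split_ifs with h h'
    · refine (WithLp.measurable_toLp 2 _).comp (measurable_pi_lambda _ fun jl => ?_)
      exact S.measurable_eval_apply (by fun_prop) (by fun_prop) jl.2
    · exact measurable_const
    · fun_prop
  refine (h3.comp hu hv).congr (Eventually.of_forall fun ω => rfl)
    (Eventually.of_forall fun ω => ?_)
  ext1 j
  simp only [Function.comp_apply, v, interpolate]
  split_ifs <;> rfl

/-- `W_i(0)` involves only the later surrogates and the data, and `Z i` is independent of these
jointly. -/
lemma indepFun_surrogate_interpolate (S : IsAugmentedSample P X φ)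
    (G : IsGaussianSurrogate P X φ Z) {n : ℕ} (i : Fin n) :
    IndepFun (Z i)
      (fun ω => interpolate (fun j : Fin n => augmented φ X k j ω) (fun j => Z j ω) i 0) P := by
  let B : Ω → (Finset.Ioo (i : ℕ) n) → Block k d := fun ω j => Z j ω
  let W : Ω → (ℕ → EuclideanSpace ℝ (Fin d)) × (ℕ × ℕ → T) :=
    fun ω => ((fun i => X i ω), (fun ij : ℕ × ℕ => φ ij.1 ij.2 ω))
  have mB : Measurable B := measurable_pi_lambda _ fun j => G.measurable j
  have mW : Measurable W := (measurable_pi_lambda _ fun j => S.measurable_data j).prodMk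
    (measurable_pi_lambda _ fun p => S.measurable_map _ _)
  have hAB : IndepFun (Z i) B P :=
    (G.iIndepFun.indepFun_finset {(i : ℕ)} (Finset.Ioo (i : ℕ) n) (by simp)
      G.measurable).comp (measurable_pi_apply (⟨(i : ℕ), by simp⟩ : ({(i : ℕ)} : Finset ℕ)))
      measurable_id
  have h2 : IndepFun (fun ω => (Z i ω, B ω)) W P :=
    (G.indepFun.comp measurable_id (ψ := fun z : ℕ → Block k d =>
      (z i, fun j : Finset.Ioo (i : ℕ) n => z j)) (by fun_prop)).symm
  have h3 := indepFun_prodMk_right (G.measurable i) mB mW hAB h2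
  let v : ((Finset.Ioo (i : ℕ) n) → Block k d) ×
      ((ℕ → EuclideanSpace ℝ (Fin d)) × (ℕ × ℕ → T)) → (Fin n → Block k d) := fun p j =>
    if j < i then WithLp.toLp 2 fun jl => (p.2.2 ((j : ℕ), (jl.1 : ℕ))).1 (p.2.1 j) jl.2
    else if h : j ≤ i then 0 else p.1 ⟨(j : ℕ), by simpa using h⟩
  have hv : Measurable v := by
    refine measurable_pi_lambda _ fun j => ?_
    simp only [v]
    split_ifs with h h'
    · refine (WithLp.measurable_toLp 2 _).comp (measurable_pi_lambda _ fun jl => ?_)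
      exact S.measurable_eval_apply (by fun_prop) (by fun_prop) jl.2
    · exact measurable_const
    · fun_prop
  refine (h3.comp measurable_id hv).congr (Eventually.of_forall fun ω => rfl)
    (Eventually.of_forall fun ω => ?_)
  ext1 j
  simp only [Function.comp_apply, v, interpolate]
  split_ifs with h1 h2 h3 h4
  · rfl
  · rfl
  · exact absurd (le_antisymm h2 (not_lt.1 h1)) h3
  · exact absurd h4.le h2
  · rfl

end Independence

/-! ### The telescoping argument. -/

section Lindeberg

variable {Ω : Type*} [MeasurableSpace Ω] {P : Measure Ω} [IsProbabilityMeasure P] {d k : ℕ}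
  {T : Set (EuclideanSpace ℝ (Fin d) → EuclideanSpace ℝ (Fin d))} [MeasurableSpace T]
  {X : ℕ → Ω → EuclideanSpace ℝ (Fin d)} {φ : ℕ → ℕ → Ω → T} {Z : ℕ → Ω → Block k d}

/-- `Cov[φ₁₁X₁] - Cov[φ₁₁X₁, φ₁₂X₁]`, entrywise. -/
def covDefect (P : Measure Ω) (X : ℕ → Ω → EuclideanSpace ℝ (Fin d)) (φ : ℕ → ℕ → Ω → T)
    (l l' : Fin d) : ℝ :=
  ∫ ω, transformed (φ 0 0) (X 0) ω l * transformed (φ 0 0) (X 0) ω l' ∂P -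
    ∫ ω, transformed (φ 0 0) (X 0) ω l * transformed (φ 0 1) (X 0) ω l' ∂P

/-- Off the diagonal blocks both moments are the cross moment of two augmentations, so they cancel.
-/
lemma integral_augmented_mul_sub (S : IsAugmentedSample P X φ) (G : IsGaussianSurrogate P X φ Z)
    (i : ℕ) (a b : Fin k × Fin d) :
    ∫ ω, augmented φ X k i ω a * augmented φ X k i ω b ∂P - ∫ ω, Z i ω a * Z i ω b ∂P =
      if a.1 = b.1 then covDefect P X φ a.2 b.2 else 0 := by
  rw [S.integral_augmented_mul, G.integral_mul S, covDefect]
  split_ifs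
  · rfl
  · exact sub_self _

/-- Source of the factor `√k`: there are `k` equal diagonal blocks and nothing else. -/
lemma sqrt_sum_blockDiagonal_sq (k : ℕ) (D : Fin d → Fin d → ℝ) :
    √(∑ a : Fin k × Fin d, ∑ b : Fin k × Fin d, (if a.1 = b.1 then D a.2 b.2 else 0) ^ 2) =
      √k * √(∑ l, ∑ l', D l l' ^ 2) := by
  rw [← Real.sqrt_mul (by positivity)]
  congr 1
  simp only [Fintype.sum_prod_type, ite_pow, ne_eq, OfNat.ofNat_ne_zero, not_false_eq_true,
    zero_pow]
  simp

/-- The bound for a single replacement of `Φ_i X_i` by `Z_i`. -/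
def swapBound (P : Measure Ω) (X : ℕ → Ω → EuclideanSpace ℝ (Fin d)) (φ : ℕ → ℕ → Ω → T)
    (k : ℕ) (α : ℕ → ℕ → ℝ≥0∞) : ℝ≥0∞ :=
  ENNReal.ofReal (√k * √(∑ l, ∑ l', covDefect P X φ l l' ^ 2)) * lambdaOne α +
    (lambdaTwo α * ((k : ℝ≥0∞) ^ (3 / 2 : ℝ) * ((d : ℝ≥0∞) ^ 3 *
      ∫⁻ ω, ‖transformed (φ 0 0) (X 0) ω‖ₑ ^ 6 ∂P) ^ (1 / 2 : ℝ)) +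
     lambdaTwo α * ((k : ℝ≥0∞) ^ (3 / 2 : ℝ) * ((d : ℝ≥0∞) ^ 3 *
      ∑ l : Fin d, ∫⁻ x, ‖x‖ₑ ^ 6 ∂(gaussianReal ((∫ ω, transformed (φ 0 0) (X 0) ω ∂P) l)
      (covMat P (transformed (φ 0 0) (X 0)) (transformed (φ 0 1) (X 0)) l l).toNNReal)) ^
        (1 / 2 : ℝ)))

variable {n q : ℕ} {f : (Fin n → Block k d) → EuclideanSpace ℝ (Fin q)} {α : ℕ → ℕ → ℝ≥0∞}

lemma enorm_integral_splice_sub_le (S : IsAugmentedSample P X φ)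
    (G : IsGaussianSurrogate P X φ Z) (hf : ThriceDifferentiable f)
    (hα : ∀ r m, noiseStability P f (fun i => augmented φ X k i) (fun i => Z i) r m = α r m)
    (hfin : ∀ r ≤ 3, ∀ m ≤ 6, α r m ≠ ∞) {h : EuclideanSpace ℝ (Fin q) → ℝ} (hh : TestBounds h)
    (i : Fin n) :
    ‖∫ ω, h (f (splice (fun j : Fin n => augmented φ X k j ω) (fun j => Z j ω) (i + 1))) ∂P -
      ∫ ω, h (f (splice (fun j : Fin n => augmented φ X k j ω) (fun j => Z j ω) i)) ∂P‖ₑ ≤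
      swapBound P X φ k α := by
  have hY := S.measurable_augmented k
  have b := fun r m => momentNorm_segmentSup_le_noiseStability (P := P) f
    (fun j : Fin n => augmented φ X k j) (fun j => Z j) r m i
  simp only [hα] at b
  have key := enorm_integral_sub_integral_le hh hf
    (ContinuousLinearMap.single ℝ (fun _ : Fin n => Block k d) i)
    (measurable_interpolate (fun j : Fin n => hY j) (fun j => G.measurable j) i)
    (hY i) (G.measurable i) (indepFun_augmented_interpolate S G i)
    (indepFun_surrogate_interpolate S G i)
    (fun a => (S.memLp_augmented_apply k i a).mono_exponent (by norm_num))
    (fun a => (G.hasGaussianLaw_apply i a).memLp_two)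
    (fun a => (S.integral_transformed_apply i a.1 a.2).trans (G.integral_apply i a).symm)
    (fun a b => integral_augmented_mul_sub S G i a b)
    (fun r _ m => (b r m).1) (fun r _ m => (b r m).2) hfin
  simp only [← interpolate_eq_add] at key
  have e1 : ∀ ω, interpolate (fun j : Fin n => augmented φ X k j ω) (fun j => Z j ω) i
      (augmented φ X k i ω) =
      splice (fun j : Fin n => augmented φ X k j ω) (fun j => Z j ω) (i + 1) := fun ω =>
    interpolate_left (fun j : Fin n => augmented φ X k j ω) (fun j => Z j ω) i
  have e2 : ∀ ω, interpolate (fun j : Fin n => augmented φ X k j ω) (fun j => Z j ω) i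
      (Z i ω) = splice (fun j : Fin n => augmented φ X k j ω) (fun j => Z j ω) i := fun ω =>
    interpolate_right (fun j : Fin n => augmented φ X k j ω) (fun j => Z j ω) i
  simp only [e1, e2] at key
  refine key.trans ?_
  rw [sqrt_sum_blockDiagonal_sq, swapBound]
  gcongr
  · exact momentNorm_norm_pow_three_le (hY i) (S.lintegral_augmented_apply_le k i)
  · exact momentNorm_norm_pow_three_le (G.measurable i) (G.lintegral_apply_le i)

lemma splice_zero {B : Type*} (y z : Fin n → B) : splice y z 0 = z := by
  ext1 j
  simp [splice]

lemma splice_self {B : Type*} (y z : Fin n → B) : splice y z n = y := by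
  ext1 j
  simp [splice]

lemma testDist_le (S : IsAugmentedSample P X φ)
    (G : IsGaussianSurrogate P X φ Z) (hf : ThriceDifferentiable f)
    (hα : ∀ r m, noiseStability P f (fun i => augmented φ X k i) (fun i => Z i) r m = α r m)
    (hfin : ∀ r ≤ 3, ∀ m ≤ 6, α r m ≠ ∞) :
    testDist P (fun ω => f fun i => augmented φ X k i ω) (fun ω => f fun i => Z i ω) ≤
      n * swapBound P X φ k α := by
  refine iSup₂_le fun h hh => ?_
  have hb := testBounds_of_mem_testClass hh
  rw [← Real.norm_eq_abs, ofReal_norm]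
  let E : ℕ → ℝ := fun m =>
    ∫ ω, h (f (splice (fun j : Fin n => augmented φ X k j ω) (fun j => Z j ω) m)) ∂P
  have h1 : ∫ ω, h (f fun i => augmented φ X k i ω) ∂P - ∫ ω, h (f fun i => Z i ω) ∂P =
      ∑ i ∈ Finset.range n, (E (i + 1) - E i) := by
    rw [Finset.sum_range_sub]
    simp only [E, splice_zero, splice_self]
  rw [h1]
  refine (enorm_sum_le _ _).trans ((Finset.sum_le_card_nsmul _ _ (swapBound P X φ k α)
    fun i hi => ?_).trans (by simp))
  exact enorm_integral_splice_sub_le S G hf hα hfin hb ⟨i, Finset.mem_range.1 hi⟩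

lemma integrable_comp_augmented_and_surrogate (S : IsAugmentedSample P X φ)
    (G : IsGaussianSurrogate P X φ Z) (hf : ThriceDifferentiable f) (hn : 0 < n)
    (hfin : noiseStability P f (fun i => augmented φ X k i) (fun i => Z i) 0 6 ≠ ∞)
    {h : EuclideanSpace ℝ (Fin q) → ℝ} (hh : TestBounds h) :
    Integrable (fun ω => h (f fun i => augmented φ X k i ω)) P ∧
      Integrable (fun ω => h (f fun i => Z i ω)) P := by
  have hfm := hf.1.continuous.measurable
  constructor
  · refine hh.integrable_comp (hfm.comp (measurable_pi_lambda _ fun i =>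
      S.measurable_augmented k i)) (ne_top_of_le_ne_top hfin ?_)
    -- At the last index, with `w` the augmented block, the interpolation is the full augmented
    -- sample; at index `0` with `w = Z_0` it is the full surrogate sample.
    let i : Fin n := ⟨n - 1, by omega⟩
    refine le_trans (momentNorm_mono fun ω => ?_) (momentNorm_segmentSup_le_noiseStability f
      (fun j : Fin n => augmented φ X k j) (fun j => Z j) 0 6 i).1
    refine le_trans (le_of_eq ?_) (enorm_le_segmentSup_zero f _ _ (augmented φ X k i) ω)
    rw [← interpolate_eq_add, interpolate_left (fun j : Fin n => augmented φ X k j ω)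
      (fun j => Z j ω) i]
    have : (i : ℕ) + 1 = n := by simp only [i]; omega
    rw [this, splice_self]
  · refine hh.integrable_comp (hfm.comp (measurable_pi_lambda _ fun i =>
      G.measurable i)) (ne_top_of_le_ne_top hfin ?_)
    let i : Fin n := ⟨0, hn⟩
    refine le_trans (momentNorm_mono fun ω => ?_) (momentNorm_segmentSup_le_noiseStability f
      (fun j : Fin n => augmented φ X k j) (fun j => Z j) 0 6 i).2
    refine le_trans (le_of_eq ?_) (enorm_le_segmentSup_zero f _ _ (Z i) ω)
    rw [← interpolate_eq_add, interpolate_right (fun j : Fin n => augmented φ X k j ω)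
      (fun j => Z j ω) i]
    exact congrArg (fun x => ‖f x‖ₑ) (splice_zero _ _).symm

end Lindeberg

/-! ### From the rate conditions to convergence. -/

section Limit

variable {l : Filter (ℕ × ℕ)} {α : ℕ → ℕ → ℕ × ℕ → ℝ≥0∞}

/-- The rate conditions are stated with `toReal`, which sends `∞` to `0`; finiteness makes the
passage to real numbers faithful. -/
lemma lambdaOne_eq_ofReal {β : ℕ → ℕ → ℝ≥0∞} (h : ∀ r ≤ 3, ∀ m ≤ 6, β r m ≠ ∞) :
    lambdaOne β = ENNReal.ofReal ((β 0 3).toReal * (β 1 3).toReal ^ 2 +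
      (β 0 3).toReal ^ 2 * (β 2 3).toReal + (β 1 2).toReal ^ 2 +
      (β 0 2).toReal * (β 2 2).toReal + (β 2 1).toReal) := by
  rw [← ENNReal.ofReal_toReal (lambdaOne_ne_top h)]
  have h02 := h 0 (by norm_num) 2 (by norm_num)
  have h03 := h 0 (by norm_num) 3 (by norm_num)
  have h12 := h 1 (by norm_num) 2 (by norm_num)
  have h13 := h 1 (by norm_num) 3 (by norm_num)
  have h21 := h 2 (by norm_num) 1 (by norm_num)
  have h22 := h 2 (by norm_num) 2 (by norm_num)
  have h23 := h 2 (by norm_num) 3 (by norm_num)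
  congr 1
  rw [lambdaOne, ENNReal.toReal_add (by finiteness) (by finiteness),
    ENNReal.toReal_add (by finiteness) (by finiteness),
    ENNReal.toReal_add (by finiteness) (by finiteness),
    ENNReal.toReal_add (by finiteness) (by finiteness)]
  simp only [ENNReal.toReal_mul, ENNReal.toReal_pow]

lemma lambdaTwo_eq_ofReal {β : ℕ → ℕ → ℝ≥0∞} (h : ∀ r ≤ 3, ∀ m ≤ 6, β r m ≠ ∞) :
    lambdaTwo β = ENNReal.ofReal ((β 1 6).toReal ^ 3 +
      (β 0 6).toReal * (β 1 6).toReal * (β 2 6).toReal +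
      (β 0 6).toReal ^ 2 * (β 3 6).toReal + (β 1 4).toReal * (β 2 4).toReal +
      (β 0 4).toReal * (β 3 4).toReal + (β 3 2).toReal) := by
  have h06 := h 0 (by norm_num) 6 (by norm_num)
  have h16 := h 1 (by norm_num) 6 (by norm_num)
  have h26 := h 2 (by norm_num) 6 (by norm_num)
  have h36 := h 3 (by norm_num) 6 (by norm_num)
  have h04 := h 0 (by norm_num) 4 (by norm_num)
  have h14 := h 1 (by norm_num) 4 (by norm_num)
  have h24 := h 2 (by norm_num) 4 (by norm_num)
  have h34 := h 3 (by norm_num) 4 (by norm_num)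
  have h32 := h 3 (by norm_num) 2 (by norm_num)
  have hne : lambdaTwo β ≠ ∞ := by
    unfold lambdaTwo
    finiteness
  rw [← ENNReal.ofReal_toReal hne]
  congr 1
  rw [lambdaTwo, ENNReal.toReal_add (by finiteness) (by finiteness),
    ENNReal.toReal_add (by finiteness) (by finiteness),
    ENNReal.toReal_add (by finiteness) (by finiteness),
    ENNReal.toReal_add (by finiteness) (by finiteness),
    ENNReal.toReal_add (by finiteness) (by finiteness)]
  simp only [ENNReal.toReal_mul, ENNReal.toReal_pow]

lemma tendsto_ofReal_mul_of_isLittleO {g : ℕ × ℕ → ℝ} {s : ℝ}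
    (h : g =o[l] fun p => 1 / ((p.1 : ℝ) * (p.2 : ℝ) ^ s)) :
    Tendsto (fun p : ℕ × ℕ => ENNReal.ofReal ((p.1 : ℝ) * (p.2 : ℝ) ^ s) *
      ENNReal.ofReal (g p)) l (𝓝 0) := by
  have h1 := ENNReal.tendsto_ofReal h.tendsto_div_nhds_zero
  rw [ENNReal.ofReal_zero] at h1
  refine h1.congr fun p => ?_
  rw [← ENNReal.ofReal_mul (by positivity)]
  congr 1
  rw [div_div_eq_mul_div, div_one, mul_comm]

lemma tendsto_lambdaOne (hfin : ∀ᶠ p in l, ∀ r ≤ 3, ∀ m ≤ 6, α r m p ≠ ∞)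
    (h : SmoothnessLambda1 (fun r m p => (α r m p).toReal) l) :
    Tendsto (fun p : ℕ × ℕ => ENNReal.ofReal ((p.1 : ℝ) * (p.2 : ℝ) ^ (1 / 2 : ℝ)) *
      lambdaOne fun r m => α r m p) l (𝓝 0) := by
  obtain ⟨h1, h2, h3, h4, h5⟩ := h
  refine (tendsto_ofReal_mul_of_isLittleO ((((h1.add h2).add h3).add h4).add h5)).congr' ?_
  filter_upwards [hfin] with p hp
  rw [lambdaOne_eq_ofReal hp]

lemma tendsto_lambdaTwo (hfin : ∀ᶠ p in l, ∀ r ≤ 3, ∀ m ≤ 6, α r m p ≠ ∞)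
    (h : SmoothnessLambda2 (fun r m p => (α r m p).toReal) l) :
    Tendsto (fun p : ℕ × ℕ => ENNReal.ofReal ((p.1 : ℝ) * (p.2 : ℝ) ^ (3 / 2 : ℝ)) *
      lambdaTwo fun r m => α r m p) l (𝓝 0) := by
  obtain ⟨h1, h2, h3, h4, h5, h6⟩ := h
  refine (tendsto_ofReal_mul_of_isLittleO
    (((((h1.add h2).add h3).add h4).add h5).add h6)).congr' ?_
  filter_upwards [hfin] with p hp
  rw [lambdaTwo_eq_ofReal hp]

end Limit

end

theorem mainTheorem5 {Ω : Type*} [MeasurableSpace Ω] (P : Measure Ω) [IsProbabilityMeasure P]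
    (d : ℕ)
    -- the set of transformations, with a σ-algebra making `(φ, x) ↦ φ x` measurable
    (T : Set (EuclideanSpace ℝ (Fin d) → EuclideanSpace ℝ (Fin d))) [MeasurableSpace T]
    (hT : Measurable fun p : T × EuclideanSpace ℝ (Fin d) => p.1.1 p.2)
    -- i.i.d. observations
    (X : ℕ → Ω → EuclideanSpace ℝ (Fin d)) (hXm : ∀ i, Measurable (X i))
    (hXi : iIndepFun X P) (hXd : ∀ i, IdentDistrib (X i) (X 0) P P)
    -- i.i.d. transformations, independent of the observations
    (φ : ℕ → ℕ → Ω → T) (hφm : ∀ i j, Measurable (φ i j))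
    (hφi : iIndepFun (fun ij : ℕ × ℕ => φ ij.1 ij.2) P)
    (hφd : ∀ i j, IdentDistrib (φ i j) (φ 0 0) P P)
    (hXφ : IndepFun (fun ω i => X i ω) (fun ω (ij : ℕ × ℕ) => φ ij.1 ij.2 ω) P)
    -- finite sixth moment of `φ₁₁X₁`
    (hmom : MemLp (transformed (φ 0 0) (X 0)) 6 P)
    -- for every `k`, i.i.d. Gaussian vectors in `ℝ^{kd}`, independent of data and transformations
    (Z : (k : ℕ) → ℕ → Ω → Block k d) (hZm : ∀ k i, Measurable (Z k i))
    (hZi : ∀ k, iIndepFun (Z k) P)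
    (hZg : ∀ k i, HasGaussianLaw (Z k i) P)
    (hZmean : ∀ k i, ∫ ω, Z k i ω ∂P =
      WithLp.toLp 2 fun jl => (∫ ω, transformed (φ 0 0) (X 0) ω ∂P) jl.2)
    (hZvar : ∀ k i, covMat P (Z k i) (Z k i) =
      (Matrix.of fun _ _ => (1 : ℝ)) ⊗ₖ
        covMat P (transformed (φ 0 0) (X 0)) (transformed (φ 0 1) (X 0)))
    (hZind : ∀ k, IndepFun (fun ω => ((fun i => X i ω), (fun ij : ℕ × ℕ => φ ij.1 ij.2 ω)))
      (fun ω i => Z k i ω) P)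
    -- the statistics
    (q : ℕ → ℕ → ℕ)
    (f : (n k : ℕ) → (Fin n → Block k d) → EuclideanSpace ℝ (Fin (q n k)))
    (hf : ∀ n k, TimesDifferentiable 3 (f n k))
    -- the regime in which `n` and `k` grow
    (l : Filter (ℕ × ℕ)) (hl : l ≤ atTop)
    (α : ℕ → ℕ → ℕ × ℕ → ℝ≥0∞)
    (hα : ∀ r m p, α r m p = noiseStability P (f p.1 p.2)
      (fun i => augmented φ X p.2 i) (fun i => Z p.2 i) r m)
    (hfin : ∀ᶠ p in l, ∀ r ≤ 3, α r 6 p ≠ ∞)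
    (hlam2 : SmoothnessLambda2 (fun r m p => (α r m p).toReal) l)
    (hlam1 : SmoothnessLambda1 (fun r m p => (α r m p).toReal) l) :
    (∀ᶠ p : ℕ × ℕ in l, ∀ h ∈ testClass (q p.1 p.2),
      Integrable (fun ω => h (f p.1 p.2 fun i => augmented φ X p.2 i ω)) P ∧
      Integrable (fun ω => h (f p.1 p.2 fun i => Z p.2 i ω)) P) ∧
    Tendsto (fun p : ℕ × ℕ => testDist P
      (fun ω => f p.1 p.2 fun i => augmented φ X p.2 i ω)
      (fun ω => f p.1 p.2 fun i => Z p.2 i ω)) l (𝓝 0) := by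
  have S : IsAugmentedSample P X φ := ⟨hT, hXm, hXi, hXd, hφm, hφi, hφd, hXφ, hmom⟩
  have G : ∀ k, IsGaussianSurrogate P X φ (Z k) := fun k =>
    ⟨hZm k, hZi k, hZg k, hZmean k, hZvar k, hZind k⟩
  -- On a probability space, finite sixth moments give finite moments of every order up to six.
  have hfin' : ∀ᶠ p in l, ∀ r ≤ 3, ∀ m ≤ 6, α r m p ≠ ∞ := by
    filter_upwards [hfin] with p hp r hr m hm
    rw [hα]
    exact noiseStability_ne_top _ _ _ hm (hα r 6 p ▸ hp r hr)
  refine ⟨?_, ?_⟩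
  · filter_upwards [hfin, hl (eventually_ge_atTop (1, 1))] with p hp hp1 h hh
    exact integrable_comp_augmented_and_surrogate S (G p.2) (hf p.1 p.2).thrice hp1.1
      (hα 0 6 p ▸ hp 0 (by norm_num)) (testBounds_of_mem_testClass hh)
  -- `c1`, `c2`, `c3` depend on `d` and on the laws of `φ₁₁X₁` and `(φ₁₁X₁, φ₁₂X₁)`, but not on `n`
  -- or `k`.
  · set c1 : ℝ := √(∑ l, ∑ l', covDefect P X φ l l' ^ 2)
    set c2 : ℝ≥0∞ := ((d : ℝ≥0∞) ^ 3 *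
      ∫⁻ ω, ‖transformed (φ 0 0) (X 0) ω‖ₑ ^ 6 ∂P) ^ (1 / 2 : ℝ)
    set c3 : ℝ≥0∞ := ((d : ℝ≥0∞) ^ 3 *
      ∑ l : Fin d, ∫⁻ x, ‖x‖ₑ ^ 6 ∂(gaussianReal ((∫ ω, transformed (φ 0 0) (X 0) ω ∂P) l)
      (covMat P (transformed (φ 0 0) (X 0)) (transformed (φ 0 1) (X 0)) l l).toNNReal)) ^
        (1 / 2 : ℝ)
    have hc2 : c2 ≠ ∞ := by
      have := S.lintegral_transformed_ne_top
      exact ENNReal.rpow_ne_top_of_nonneg (by norm_num) (by finiteness)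
    have hc3 : c3 ≠ ∞ := by
      refine ENNReal.rpow_ne_top_of_nonneg (by norm_num) (ENNReal.mul_ne_top (by finiteness) ?_)
      exact ENNReal.sum_ne_top.2 fun l _ => lintegral_gaussianReal_pow_six_ne_top _ _
    have t1 := ENNReal.Tendsto.const_mul (tendsto_lambdaOne hfin' hlam1)
      (a := ENNReal.ofReal c1) (Or.inr ENNReal.ofReal_ne_top)
    have t2 := ENNReal.Tendsto.const_mul (tendsto_lambdaTwo hfin' hlam2)
      (a := c2 + c3) (Or.inr (by finiteness))
    have t := t1.add t2
    simp only [mul_zero, add_zero] at t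
    refine tendsto_of_tendsto_of_tendsto_of_le_of_le' tendsto_const_nhds t
      (Eventually.of_forall fun _ => zero_le) ?_
    filter_upwards [hfin'] with p hp
    -- The bound equals `c1 · (n √k λ₁) + (c2 + c3) · (n k^{3/2} λ₂)`, and both brackets tend to
    -- zero.
    refine (testDist_le S (G p.2) (hf p.1 p.2).thrice (fun r m => (hα r m p).symm) hp).trans
      (le_of_eq ?_)
    have hk : ENNReal.ofReal ((p.2 : ℝ) ^ (3 / 2 : ℝ)) = (p.2 : ℝ≥0∞) ^ (3 / 2 : ℝ) := by
      rw [← ENNReal.ofReal_rpow_of_nonneg (by positivity) (by norm_num), ENNReal.ofReal_natCast]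
    rw [swapBound, ENNReal.ofReal_mul (Real.sqrt_nonneg _), ENNReal.ofReal_mul (by positivity),
      ENNReal.ofReal_mul (by positivity), ENNReal.ofReal_natCast, hk, ← Real.sqrt_eq_rpow]
    ring
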